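/- **Setting.** Let $\mathbb R^{p\times q}$ carry the trace inner product and the Frobenius norm, and let $V_k$ denote the $k$-th column of $V$. Let $f:\mathbb R^{m\times n}\times\mathbb R^{m\times n}\to[0,\infty)$ be locally Lipschitz, $\lambda,\beta\ge 0$, $\tau\in[0,+\infty]$, $\kappa^1_{ij}\in[-\infty,0]$, $\kappa^2_{ij}\in[0,+\infty]$, and put $\mathcal B^X=\{X\in\mathbb R^{m\times d}:\|X_k\|_2\le\tau\ \forall k\}$, $\mathcal B^Y=\{Y\in\mathbb R^{n\times d}:\|Y_k\|_2\le\tau\ \forall k\}$, $\mathcal B^S=\{S\in\mathbb R^{m\times n}:\kappa^1_{ij}\le S_{ij}\le\kappa^2_{ij}\ \forall i,j\}$, $\mathcal B=\mathcal B^X\times\mathcal B^Y\times\mathcal B^S$. Let $\mathrm{nnzc}$ be the number of nonzero columns and $\|\cdot\|_0$ the number of nonzero entries, and consider $$\text{(FB)}\quad \min_{(X,Y,S)\in\mathcal B} f(XY^{T},S)+\lambda\big(\mathrm{nnzc}(X)+\mathrm{nnzc}(Y)\big)+\beta\|S\|_0 .$$ Let $\theta_1:[0,\infty)\to[0,\infty)$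 be locally Lipschitz with $\theta_1(0)=0$, $\theta_1(1)=1$, $\theta_1(t)\in(0,1)$ for $t\in(0,1)$ and $\theta_1(t)>1$ for $t>1$; let $\theta_2\equiv1$, $\theta=\min\{\theta_1,\theta_2\}$, and for $r,s>0$ consider $$\text{(FR)}\quad \min_{(X,Y,S)\in\mathcal B} f(XY^{T},S)+\lambda\Big(\sum_k\theta\big(\tfrac{\|X_k\|_2}{r}\big)+\sum_k\theta\big(\tfrac{\|Y_k\|_2}{r}\big)\Big)+\beta\sum_{i,j}\theta\big(\tfrac{|S_{ij}|}{s}\big).$$ Let $\partial$ be the limiting (Mordukhovich) subdifferential, $\partial^c$ the Clarke subdifferential, and $N_C$ the limiting normal cone to $C$. **Assumption.** (i) If $\lambda>0$, then for every $k$ the function $f(XY^{T},S)$ is Lipschitz on $\mathcal B$ with respect to $X_k$ with constant $L_X>0$ and with respect to $Y_k$ with constant $L_Y>0$; if $\beta>0$, then for all $i,j$ it is Lipschitz on $\mathcal B$ with respect to $S_{ij}$ with constant $L_S>0$. (ii) $\eta:=\inf\bigcup_{t\in(0,1)}\partial^c\theta_1(t)>0$; if $\lambda>0$ then $r<\min\{\tau,\lambda\eta/\max\{L_X,L_Y\}\}$,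 and if $\beta>0$ then $s<\beta\eta/L_S$. **Notions.** Let $\mathbb I_V=\{k:V_k\ne0\}$ if $\lambda>0$ and $\mathbb I_V$ the set of all column indices if $\lambda=0$; let $\mathbb J_S=\{(i,j):S_{ij}\ne0\}$ if $\beta>0$ and $\mathbb J_S$ the set of all index pairs if $\beta=0$. Let $\underline{\mathcal B}^X_{\mathbb I}$ (resp. $\underline{\mathcal B}^Y_{\mathbb I}$, $\underline{\mathcal B}^S_{\mathbb J}$) be obtained from $\mathcal B^X$ (resp. $\mathcal B^Y$, $\mathcal B^S$) by replacing in each of its elements the columns outside $\mathbb I$ (resp. the entries outside $\mathbb J$) by zero. A point $(X,Y,S)\in\mathcal B$ is *stationary for (FB)* if there is $(H_Z,H_S)\in\partial f(XY^{T},S)$ with $$0\in H_ZY+N_{\underline{\mathcal B}^X_{\mathbb I_X}}(X),\quad 0\in H_Z^{T}X+N_{\underline{\mathcal B}^Y_{\mathbb I_Y}}(Y),\quad 0\in H_S+N_{\underline{\mathcal B}^S_{\mathbb J_S}}(S).$$ It is *stationary for (FR)* if there is $(H_Z,H_S)\in\partial f(XY^{T},S)$ with $$0\in H_ZY+\lambda\,\partial\Theta_I(X)+N_{\mathcal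 B^X}(X),\quad 0\in H_Z^{T}X+\lambda\,\partial\Theta_{I'}(Y)+N_{\mathcal B^Y}(Y),\quad 0\in H_S+\beta\,\partial\tilde\Theta_J(S)+N_{\mathcal B^S}(S),$$ where $\Theta_I(V)=\sum_k\theta_{I_k}(\|V_k\|_2/r)$, $\tilde\Theta_J(T)=\sum_{i,j}\theta_{J_{ij}}(|T_{ij}|/s)$, and the index vectors are fixed at the point: $I_k$ (resp. $I'_k$, $J_{ij}$) is the largest $l\in\{1,2\}$ with $\theta_l(t)=\theta(t)$ at $t=\|X_k\|_2/r$ (resp. $\|Y_k\|_2/r$, $|S_{ij}|/s$); however $I_k=I'_k=2$ if $\lambda=0$ and $J_{ij}=2$ if $\beta=0$. *Consistency* (C1) means $\mathbb I_X=\mathbb I_Y$. *Isolation* (C2) means $\|X_k\|_2,\|Y_k\|_2\notin(0,r)$ for all $k$ if $\lambda>0$, and $|S_{ij}|\notin(0,s)$ for all $i,j$ if $\beta>0$. A *strong stationary point* of (FB) or (FR) is a stationary point of that problem satisfying (C1) and (C2). Write $\mathcal G$ for the set of global minimizers and $\mathcal S^s$ for the set of strong stationary points. **Theorem.** Under the Assumption,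 $$\mathcal G_{(FR)}=\mathcal G_{(FB)}\subseteq\mathcal S^s_{(FB)}\cap\mathcal S^s_{(FR)}\qquad\text{and}\qquad \mathcal S^s_{(FR)}\subseteq\mathcal S^s_{(FB)}.$$ Moreover $\mathcal S^s_{(FB)}=\mathcal S^s_{(FR)}$, provided that, in case $\beta>0$, the constant $L_S$ also bounds the local Lipschitz modulus of $f$ with respect to the entries of $S$ at feasible points, i.e. for every $(X,Y,S)\in\mathcal B$, all $i,j$ with $\kappa^1_{ij}<\kappa^2_{ij}$ and every $L'>L_S$ there is a neighbourhood of $(XY^{T},S)$ in $\mathbb R^{m\times n}\times\mathbb R^{m\times n}$ on which $f$ is Lipschitz with constant $L'$ with respect to the $(i,j)$ entry of its second argument. -/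

import Mathlib

open Filter Topology Set

noncomputable section

namespace RPCA

/-! ### Variational analysis -/

section Variational

variable {E : Type*} [NormedAddCommGroup E] [InnerProductSpace ℝ E]

/-- Regular (Fréchet) normal cone to `C` at `x`:
`⟨v, y - x⟩ ≤ o(‖y - x‖)` for `y → x`, `y ∈ C`. -/
def regularNormalCone (C : Set E) (x : E) : Set E :=
  {v | ∀ ε : ℝ, 0 < ε → ∀ᶠ y in 𝓝[C] x, inner ℝ v (y - x) ≤ ε * ‖y - x‖}

/-- Limiting (Mordukhovich) normal cone to `C` at `x ∈ C`. -/
def normalCone (C : Set E) (x : E) : Set E :=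
  {v | ∃ (y : ℕ → E) (w : ℕ → E), (∀ k, y k ∈ C) ∧ (∀ k, w k ∈ regularNormalCone C (y k)) ∧
    Tendsto y atTop (𝓝 x) ∧ Tendsto w atTop (𝓝 v)}

/-- Regular (Fréchet) subdifferential:
`g y ≥ g x + ⟨v, y - x⟩ - o(‖y - x‖)` for `y → x`. -/
def regularSubdiff (g : E → ℝ) (x : E) : Set E :=
  {v | ∀ ε : ℝ, 0 < ε → ∀ᶠ y in 𝓝 x, g x + inner ℝ v (y - x) - ε * ‖y - x‖ ≤ g y}

/-- Limiting (Mordukhovich) subdifferential of a finite-valued function. -/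
def limitingSubdiff (g : E → ℝ) (x : E) : Set E :=
  {v | ∃ (y : ℕ → E) (w : ℕ → E), (∀ k, w k ∈ regularSubdiff g (y k)) ∧
    Tendsto y atTop (𝓝 x) ∧ Tendsto (fun k => g (y k)) atTop (𝓝 (g x)) ∧
    Tendsto w atTop (𝓝 v)}

/-- Clarke's generalized directional derivative
`limsup_{y → x, h ↓ 0} (g (y + h v) - g y) / h`, as an extended real. -/
def clarkeDirDeriv (g : E → ℝ) (x v : E) : EReal :=
  limsup (fun p : E × ℝ => (((g (p.1 + p.2 • v) - g p.1) / p.2 : ℝ) : EReal))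
    (𝓝 x ×ˢ 𝓝[>] (0 : ℝ))

/-- Clarke subdifferential. -/
def clarkeSubdiff (g : E → ℝ) (x : E) : Set E :=
  {ξ | ∀ v : E, ((inner ℝ ξ v : ℝ) : EReal) ≤ clarkeDirDeriv g x v}

end Variational

/-! ### Matrices -/

/-- The space of real `p × q` matrices with the trace inner product and the Frobenius norm;
the `(i, j)` entry of `U` is `U (i, j)`. -/
abbrev Mat (p q : ℕ) : Type := EuclideanSpace ℝ (Fin p × Fin q)

/-- The `k`-th column, with its Euclidean norm. -/
def col {p q : ℕ} (U : Mat p q) (k : Fin q) : EuclideanSpace ℝ (Fin p) :=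
  WithLp.toLp 2 fun i => U (i, k)

/-- `X Yᵀ`. -/
def mulT {m n d : ℕ} (X : Mat m d) (Y : Mat n d) : Mat m n :=
  WithLp.toLp 2 fun p => ∑ k, X (p.1, k) * Y (p.2, k)

/-- `H Y`. -/
def mul {m n d : ℕ} (H : Mat m n) (Y : Mat n d) : Mat m d :=
  WithLp.toLp 2 fun p => ∑ j, H (p.1, j) * Y (j, p.2)

/-- `Hᵀ X`. -/
def tmul {m n d : ℕ} (H : Mat m n) (X : Mat m d) : Mat n d :=
  WithLp.toLp 2 fun p => ∑ i, H (i, p.1) * X (i, p.2)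

open Classical in
/-- Keep the columns with index in `I`, replace the others by zero. -/
def restrictCols {p q : ℕ} (I : Set (Fin q)) (U : Mat p q) : Mat p q :=
  WithLp.toLp 2 fun e => if e.2 ∈ I then U e else 0

open Classical in
/-- Keep the entries with index in `J`, replace the others by zero. -/
def restrictEntries {p q : ℕ} (J : Set (Fin p × Fin q)) (U : Mat p q) : Mat p q :=
  WithLp.toLp 2 fun e => if e ∈ J then U e else 0

/-- Triples `(X, Y, S)`. -/
abbrev Triple (m n d : ℕ) : Type := Mat m d × Mat n d × Mat m n

/-! ### The problem (FB) -/

/-- The data of the constrained factorization problem, with its standing conditions. -/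
structure Problem (m n d : ℕ) where
  /-- the loss -/
  f : Mat m n → Mat m n → ℝ
  f_nonneg : ∀ Z S, 0 ≤ f Z S
  f_locallyLipschitz : LocallyLipschitz fun p : Mat m n × Mat m n => f p.1 p.2
  /-- weight of the column sparsity regularizers -/
  lam : ℝ
  lam_nonneg : 0 ≤ lam
  /-- weight of the entrywise sparsity regularizer -/
  beta : ℝ
  beta_nonneg : 0 ≤ beta
  /-- bound on the column norms, possibly `+∞` -/
  tau : ENNReal
  /-- lower and upper bounds of the box for `S`, possibly infinite -/
  kappa₁ : Fin m → Fin n → EReal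
  kappa₂ : Fin m → Fin n → EReal
  kappa₁_nonpos : ∀ i j, kappa₁ i j ≤ 0
  kappa₂_nonneg : ∀ i j, 0 ≤ kappa₂ i j

/-- `ϑ(t) = 1` if `t > 0` and `0` otherwise. -/
def vartheta (t : ℝ) : ℝ := if 0 < t then 1 else 0

/-- Number of nonzero columns. -/
def nnzc {p q : ℕ} (V : Mat p q) : ℝ := ∑ k, vartheta ‖col V k‖

/-- Number of nonzero entries. -/
def ell0 {p q : ℕ} (S : Mat p q) : ℝ := ∑ i, ∑ j, vartheta |S (i, j)|

/-- `θ₂ ≡ 1` and `θ = min {θ₁, θ₂}`. -/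
def theta₂ : ℝ → ℝ := fun _ => 1

def theta (θ₁ : ℝ → ℝ) : ℝ → ℝ := fun t => min (θ₁ t) (theta₂ t)

/-- `Θ^ρ(V) = ∑ₖ θ(‖Vₖ‖ / ρ)`. -/
def colPenalty (θ₁ : ℝ → ℝ) (ρ : ℝ) {p q : ℕ} (V : Mat p q) : ℝ :=
  ∑ k, theta θ₁ (‖col V k‖ / ρ)

/-- `Θ̃^ρ(S) = ∑ᵢⱼ θ(|Sᵢⱼ| / ρ)`. -/
def entryPenalty (θ₁ : ℝ → ℝ) (ρ : ℝ) {p q : ℕ} (S : Mat p q) : ℝ :=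
  ∑ i, ∑ j, theta θ₁ (|S (i, j)| / ρ)

/-- `θ_b` for `b ∈ {1, 2}`; the label `1` is coded as `false` and `2` as `true`. -/
def thetaSel (θ₁ : ℝ → ℝ) (b : Bool) : ℝ → ℝ := if b then theta₂ else θ₁

open Classical in
/-- `max {j ∈ {1, 2} : θ_j(t) = θ(t)}`, coded as in `thetaSel`
(the set is nonempty because `θ = min {θ₁, θ₂}`). -/
def activeIndex (θ₁ : ℝ → ℝ) (t : ℝ) : Bool := decide (theta₂ t = theta θ₁ t)

/-- `Θ^ρ_I(V) = ∑ₖ θ_{Iₖ}(‖Vₖ‖ / ρ)`. -/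
def colPenaltySel (θ₁ : ℝ → ℝ) (ρ : ℝ) {p q : ℕ} (I : Fin q → Bool) (V : Mat p q) : ℝ :=
  ∑ k, thetaSel θ₁ (I k) (‖col V k‖ / ρ)

/-- `Θ̃^ρ_J(S) = ∑ᵢⱼ θ_{Jᵢⱼ}(|Sᵢⱼ| / ρ)`. -/
def entryPenaltySel (θ₁ : ℝ → ℝ) (ρ : ℝ) {p q : ℕ} (J : Fin p → Fin q → Bool)
    (S : Mat p q) : ℝ :=
  ∑ i, ∑ j, thetaSel θ₁ (J i j) (|S (i, j)| / ρ)

namespace Problem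

variable {m n d : ℕ} (P : Problem m n d)

/-- The ball constraint `{V : ‖Vₖ‖ ≤ τ for all k}` (used for both `X` and `Y`). -/
def ballSet (p : ℕ) : Set (Mat p d) := {V | ∀ k, ENNReal.ofReal ‖col V k‖ ≤ P.tau}

/-- The box constraint for `S`. -/
def boxSet : Set (Mat m n) :=
  {S | ∀ i j, P.kappa₁ i j ≤ ((S (i, j) : ℝ) : EReal) ∧ ((S (i, j) : ℝ) : EReal) ≤ P.kappa₂ i j}

/-- The feasible set `𝓑 = 𝓑^X × 𝓑^Y × 𝓑^S`. -/
def feasible : Set (Triple m n d) :=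
  {W | W.1 ∈ P.ballSet m ∧ W.2.1 ∈ P.ballSet n ∧ W.2.2 ∈ P.boxSet}

/-- The objective of (FB). -/
def F (W : Triple m n d) : ℝ :=
  P.f (mulT W.1 W.2.1) W.2.2 + P.lam * (nnzc W.1 + nnzc W.2.1) + P.beta * ell0 W.2.2

/-- The objective of (FR). -/
def Frelax (θ₁ : ℝ → ℝ) (r s : ℝ) (W : Triple m n d) : ℝ :=
  P.f (mulT W.1 W.2.1) W.2.2 + P.lam * (colPenalty θ₁ r W.1 + colPenalty θ₁ r W.2.1)
    + P.beta * entryPenalty θ₁ s W.2.2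

/-- Global minimizers of (FB). -/
def globalMin : Set (Triple m n d) :=
  {W | W ∈ P.feasible ∧ ∀ W' ∈ P.feasible, P.F W ≤ P.F W'}

/-- Global minimizers of (FR). -/
def globalMinRelax (θ₁ : ℝ → ℝ) (r s : ℝ) : Set (Triple m n d) :=
  {W | W ∈ P.feasible ∧ ∀ W' ∈ P.feasible, P.Frelax θ₁ r s W ≤ P.Frelax θ₁ r s W'}

/-- The index set `𝕀_V`: the nonzero columns if `λ > 0`, all columns if `λ = 0`. -/
def colSupport {p : ℕ} (V : Mat p d) : Set (Fin d) := {k | 0 < P.lam → col V k ≠ 0}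

/-- The index set `𝕁_S`: the nonzero entries if `β > 0`, all entries if `β = 0`. -/
def entrySupport (S : Mat m n) : Set (Fin m × Fin n) := {e | 0 < P.beta → S e ≠ 0}

/-- The limiting subdifferential of `f`, as a function of the pair `(Z, S)`. -/
def lossSubdiff (Z S : Mat m n) : Set (Mat m n × Mat m n) :=
  {H | WithLp.toLp 2 H ∈
    limitingSubdiff (fun p : WithLp 2 (Mat m n × Mat m n) => P.f p.fst p.snd)
      (WithLp.toLp 2 (Z, S))}

/-- Stationary points of (FB). -/
def IsStationary (W : Triple m n d) : Prop :=
  W ∈ P.feasible ∧ ∃ H ∈ P.lossSubdiff (mulT W.1 W.2.1) W.2.2,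
    -(mul H.1 W.2.1) ∈ normalCone (restrictCols (P.colSupport W.1) '' P.ballSet m) W.1 ∧
    -(tmul H.1 W.1) ∈ normalCone (restrictCols (P.colSupport W.2.1) '' P.ballSet n) W.2.1 ∧
    -H.2 ∈ normalCone (restrictEntries (P.entrySupport W.2.2) '' P.boxSet) W.2.2

open Classical in
/-- The index vector `I^{ρ,V}`. -/
def colIndex (θ₁ : ℝ → ℝ) (ρ : ℝ) {p : ℕ} (V : Mat p d) : Fin d → Bool :=
  fun k => if 0 < P.lam then activeIndex θ₁ (‖col V k‖ / ρ) else true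

open Classical in
/-- The index matrix `J^{ρ,S}`. -/
def entryIndex (θ₁ : ℝ → ℝ) (ρ : ℝ) (S : Mat m n) : Fin m → Fin n → Bool :=
  fun i j => if 0 < P.beta then activeIndex θ₁ (|S (i, j)| / ρ) else true

/-- Stationary points of (FR). The index vectors are frozen at the point `W`. -/
def IsStationaryRelax (θ₁ : ℝ → ℝ) (r s : ℝ) (W : Triple m n d) : Prop :=
  W ∈ P.feasible ∧ ∃ H ∈ P.lossSubdiff (mulT W.1 W.2.1) W.2.2,
    (∃ G ∈ limitingSubdiff (colPenaltySel θ₁ r (P.colIndex θ₁ r W.1)) W.1,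
      ∃ v ∈ normalCone (P.ballSet m) W.1, 0 = mul H.1 W.2.1 + P.lam • G + v) ∧
    (∃ G ∈ limitingSubdiff (colPenaltySel θ₁ r (P.colIndex θ₁ r W.2.1)) W.2.1,
      ∃ v ∈ normalCone (P.ballSet n) W.2.1, 0 = tmul H.1 W.1 + P.lam • G + v) ∧
    (∃ G ∈ limitingSubdiff (entryPenaltySel θ₁ s (P.entryIndex θ₁ s W.2.2)) W.2.2,
      ∃ v ∈ normalCone P.boxSet W.2.2, 0 = H.2 + P.beta • G + v)

/-- Consistency (C1). -/
def Consistent (W : Triple m n d) : Prop := P.colSupport W.1 = P.colSupport W.2.1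

/-- Isolation (C2). -/
def Isolated (r s : ℝ) (W : Triple m n d) : Prop :=
  (0 < P.lam → ∀ k, ‖col W.1 k‖ ∉ Ioo 0 r ∧ ‖col W.2.1 k‖ ∉ Ioo 0 r) ∧
  (0 < P.beta → ∀ i j, |W.2.2 (i, j)| ∉ Ioo 0 s)

/-- Strong stationary points of (FB). -/
def strongStationary (r s : ℝ) : Set (Triple m n d) :=
  {W | P.IsStationary W ∧ P.Consistent W ∧ P.Isolated r s W}

/-- Strong stationary points of (FR). -/
def strongStationaryRelax (θ₁ : ℝ → ℝ) (r s : ℝ) : Set (Triple m n d) :=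
  {W | P.IsStationaryRelax θ₁ r s W ∧ P.Consistent W ∧ P.Isolated r s W}

/-- Lipschitz condition on the feasible set: `f(XYᵀ, S)` is Lipschitz in each single column of
`X` and of `Y` with constants `L_X`, `L_Y` if `λ > 0`, and in each single entry of `S` with
constant `L_S` if `β > 0`. -/
structure LipschitzOnFeasible (L_X L_Y L_S : ℝ) : Prop where
  pos_X : 0 < P.lam → 0 < L_X
  pos_Y : 0 < P.lam → 0 < L_Y
  pos_S : 0 < P.beta → 0 < L_S
  lip_X : 0 < P.lam → ∀ k X X' Y S, (X, Y, S) ∈ P.feasible → (X', Y, S) ∈ P.feasible →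
    (∀ l, l ≠ k → col X l = col X' l) →
    |P.f (mulT X Y) S - P.f (mulT X' Y) S| ≤ L_X * ‖col X k - col X' k‖
  lip_Y : 0 < P.lam → ∀ k X Y Y' S, (X, Y, S) ∈ P.feasible → (X, Y', S) ∈ P.feasible →
    (∀ l, l ≠ k → col Y l = col Y' l) →
    |P.f (mulT X Y) S - P.f (mulT X Y') S| ≤ L_Y * ‖col Y k - col Y' k‖
  lip_S : 0 < P.beta → ∀ e X Y S S', (X, Y, S) ∈ P.feasible → (X, Y, S') ∈ P.feasible →
    (∀ e', e' ≠ e → S e' = S' e') →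
    |P.f (mulT X Y) S - P.f (mulT X Y) S'| ≤ L_S * |S e - S' e|

/-- If `β > 0`: at every feasible `(X, Y, S)`, the local Lipschitz modulus of `f` at `(XYᵀ, S)`
with respect to each entry of `S` with a nondegenerate interval is at most `L_S`, that is, for
every `L' > L_S`, `f` is `L'`-Lipschitz in that entry on a neighbourhood of `(XYᵀ, S)`. -/
def EntryModulusLE (L_S : ℝ) : Prop :=
  0 < P.beta → ∀ X Y S, (X, Y, S) ∈ P.feasible →
    ∀ i j, P.kappa₁ i j < P.kappa₂ i j → ∀ L' : ℝ, L_S < L' →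
      ∃ U ∈ 𝓝 (mulT X Y, S), ∀ Z S₁ S₂, (Z, S₁) ∈ U → (Z, S₂) ∈ U →
        (∀ e, e ≠ (i, j) → S₁ e = S₂ e) →
        |P.f Z S₁ - P.f Z S₂| ≤ L' * |S₁ (i, j) - S₂ (i, j)|

end Problem

/-- The conditions on `θ₁ : [0, ∞) → [0, ∞)` (values at negative arguments are irrelevant):
`θ₁(0) = 0`, `θ₁(1) = 1`, `θ₁ ∈ (0, 1)` on `(0, 1)`, `θ₁ > 1` on `(1, ∞)`, local Lipschitz
continuity, and `η > 0` is the infimum of all Clarke subgradients at points of `(0, 1)`. -/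
structure IsGenerator (θ₁ : ℝ → ℝ) (η : ℝ) : Prop where
  zero : θ₁ 0 = 0
  one : θ₁ 1 = 1
  mem_Ioo : ∀ t ∈ Ioo (0 : ℝ) 1, θ₁ t ∈ Ioo (0 : ℝ) 1
  one_lt : ∀ t, 1 < t → 1 < θ₁ t
  locallyLipschitzOn : LocallyLipschitzOn (Ici 0) θ₁
  eta_pos : 0 < η
  isGLB_eta : IsGLB (⋃ t ∈ Ioo (0 : ℝ) 1, clarkeSubdiff θ₁ t) η

/-- The choice of the relaxation parameters `r, s > 0`. -/
structure AdmissibleRadii {m n d : ℕ} (P : Problem m n d) (L_X L_Y L_S η r s : ℝ) : Prop where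
  r_pos : 0 < r
  s_pos : 0 < s
  r_lt_tau : 0 < P.lam → ENNReal.ofReal r < P.tau
  r_lt : 0 < P.lam → r < P.lam * η / max L_X L_Y
  s_lt : 0 < P.beta → s < P.beta * η / L_S

end RPCA

end

/-!
The link between the two problems is the slope estimate `η t ≤ θ₁ t` on `[0, 1]`
(`IsGenerator.eta_mul_le`): by Rolle's argument every chord slope of `θ₁` is a Clarke subgradient
at an intermediate point, hence at least `η`. By the choice of `r` and `s`, zeroing a column of
norm in `(0, r)` or an entry of modulus in `(0, s)` gains more in the relaxed penalty than the
Lipschitz condition lets the loss increase (`exists_lt_of_not_isolated`). So minimizers of (FR) are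
isolated, every feasible point is dominated by an isolated one, and at isolated points the two
objectives agree; as the relaxed objective never exceeds the other, the minimizers coincide.
Consistency of a minimizer holds because a column of `Y` facing a zero column of `X` can be zeroed
without changing `X Yᵀ`.

Stationarity of a minimizer `(X, Y, S)` rests on a multiplier rule for minimizing `f ∘ G` over a
closed set, with `f` locally Lipschitz and `G` smooth (`exists_multiplier`), which is proved by
decoupling `z = G x` with a quadratic penalty. It is applied to the loss plus
`L_S ∑ |S'ₑ|`, the sum over the entries outside the support of `S`, on the set where `X'` and `Y'`
keep their column supports and `S'` ranges over the whole box: the Lipschitz condition on the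
feasible set makes `(X, Y, S)` a minimizer of this function
(`globalMin_subset_strongStationaryRelax`). The `ℓ¹` term produces entries of modulus at most `L_S`,
and `L_S ≤ β η / s` makes them `β` times subgradients of the frozen penalty, which has a kink of
slope at least `η / s` at `0`. In the column blocks nothing is needed off the support: by consistency `H_Z Y` and
`H_Zᵀ X` vanish there.

The two notions of stationarity are compared through the constraint sets, which are products along
the support (`SplitsAlong`): normal vectors to the restricted set are those of the full set with
arbitrary entries off the support. On the support the frozen penalties are constant, so that their
subgradients vanish, and (FR) implies (FB). For the converse, the bound on the entrywise Lipschitz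
modulus of the loss gives `|(H_S)ₑ| ≤ L_S` off the support, unless the interval of `e` is `{0}`,
where every number is normal.
-/

namespace RPCA

/-! ### Regular and limiting subgradients -/

section Subgradients

variable {E F : Type*} [NormedAddCommGroup E] [InnerProductSpace ℝ E]
  [NormedAddCommGroup F] [InnerProductSpace ℝ F]

theorem regularSubdiff_subset_limitingSubdiff (g : E → ℝ) (x : E) :
    regularSubdiff g x ⊆ limitingSubdiff g x := fun v hv =>
  ⟨fun _ => x, fun _ => v, fun _ => hv, tendsto_const_nhds, tendsto_const_nhds,
    tendsto_const_nhds⟩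

theorem mem_limitingSubdiff_of_eventually_le {g : E → ℝ} {x v : E}
    (h : ∀ᶠ y in 𝓝 x, g x + inner ℝ v (y - x) ≤ g y) : v ∈ limitingSubdiff g x := by
  refine regularSubdiff_subset_limitingSubdiff g x fun ε hε => ?_
  filter_upwards [h] with y hy
  have : 0 ≤ ε * ‖y - x‖ := by positivity
  linarith

theorem abs_inner_le_of_mem_regularSubdiff {g : E → ℝ} {x v w : E} {K : ℝ}
    (h : ∀ᶠ t in 𝓝 (0 : ℝ), g (x + t • v) ≤ g x + K * |t|) (hw : w ∈ regularSubdiff g x) :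
    |inner ℝ w v| ≤ K := by
  refine le_of_forall_pos_le_add fun ε hε => ?_
  have hε' : 0 < ε / (‖v‖ + 1) := by positivity
  have hc : Tendsto (fun t : ℝ => x + t • v) (𝓝 0) (𝓝 x) := by
    have : Continuous fun t : ℝ => x + t • v := by fun_prop
    simpa using this.tendsto 0
  obtain ⟨δ, hδ, hball⟩ := Metric.eventually_nhds_iff_ball.1
    (h.and (hc.eventually (hw _ hε')))
  have key : ∀ t : ℝ, |t| = δ / 2 → t * inner ℝ w v ≤ (K + ε) * (δ / 2) := by
    intro t ht
    obtain ⟨h1, h2⟩ := hball t (by rw [mem_ball_zero_iff, Real.norm_eq_abs, ht]; linarith)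
    rw [add_sub_cancel_left, inner_smul_right, norm_smul, Real.norm_eq_abs, ht] at h2
    rw [ht] at h1
    have h3 : ε / (‖v‖ + 1) * (δ / 2 * ‖v‖) ≤ ε * (δ / 2) := by
      have h4 : ε / (‖v‖ + 1) * ‖v‖ ≤ ε := by
        rw [div_mul_eq_mul_div, div_le_iff₀ (by positivity)]
        nlinarith [norm_nonneg v]
      nlinarith
    linarith
  have h1 := key (δ / 2) (abs_of_pos (by positivity))
  have h2 := key (-(δ / 2)) (by rw [abs_neg, abs_of_pos (by positivity)])
  rw [abs_le]
  constructor <;> nlinarith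

/-- If `g` is Lipschitz with constant `K` in the direction `v` near `x`, every limiting
subgradient at `x` has component at most `K` along `v`. -/
theorem abs_inner_le_of_mem_limitingSubdiff {g : E → ℝ} {x v w : E} {K : ℝ}
    (h : ∀ᶠ y in 𝓝 x, ∀ᶠ t in 𝓝 (0 : ℝ), g (y + t • v) ≤ g y + K * |t|)
    (hw : w ∈ limitingSubdiff g x) : |inner ℝ w v| ≤ K := by
  obtain ⟨y, u, hu, hy, -, hlim⟩ := hw
  have h1 : Tendsto (fun k => |inner ℝ (u k) v|) atTop (𝓝 |inner ℝ w v|) :=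
    (hlim.inner tendsto_const_nhds).abs
  refine le_of_tendsto h1 ?_
  filter_upwards [hy.eventually h] with k hk
  exact abs_inner_le_of_mem_regularSubdiff hk (hu k)

theorem mem_regularNormalCone_of_isLocalMinOn {C : Set E} {ψ : E → ℝ} {ψ' : E →L[ℝ] ℝ} {x u : E}
    (hd : HasFDerivAt ψ ψ' x) (hmin : IsLocalMinOn ψ C x) (hu : ∀ h, inner ℝ u h = -ψ' h) :
    u ∈ regularNormalCone C x := by
  intro ε hε
  have h1 : ∀ᶠ y in 𝓝[C] x, ‖ψ y - ψ x - ψ' (y - x)‖ ≤ ε * ‖y - x‖ :=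
    nhdsWithin_le_nhds ((hasFDerivAt_iff_isLittleO.1 hd).def hε)
  filter_upwards [h1, hmin] with y hy1 hy2
  rw [hu]
  have := (abs_le.1 (by simpa only [Real.norm_eq_abs] using hy1)).2
  linarith

theorem mem_regularSubdiff_of_isLocalMin {f ψ : E → ℝ} {ψ' : E →L[ℝ] ℝ} {x u : E}
    (hd : HasFDerivAt ψ ψ' x) (hmin : IsLocalMin (fun y => f y + ψ y) x)
    (hu : ∀ h, inner ℝ u h = -ψ' h) :
    u ∈ regularSubdiff f x := by
  intro ε hε
  have h1 : ∀ᶠ y in 𝓝 x, ‖ψ y - ψ x - ψ' (y - x)‖ ≤ ε * ‖y - x‖ :=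
    (hasFDerivAt_iff_isLittleO.1 hd).def hε
  filter_upwards [h1, hmin] with y hy1 hy2
  rw [hu]
  have := (abs_le.1 (by simpa only [Real.norm_eq_abs] using hy1)).2
  linarith

theorem limitingSubdiff_separable {f : E → ℝ} {g : F → ℝ} (hf : Continuous f)
    (hg : Continuous g) {x H : WithLp 2 (E × F)}
    (hH : H ∈ limitingSubdiff (fun p : WithLp 2 (E × F) => f p.fst + g p.snd) x) :
    H.fst ∈ limitingSubdiff f x.fst ∧ H.snd ∈ limitingSubdiff g x.snd := by
  obtain ⟨y, w, hw, hy, -, hlim⟩ := hH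
  have cfst : Continuous fun p : WithLp 2 (E × F) => p.fst := by fun_prop
  have csnd : Continuous fun p : WithLp 2 (E × F) => p.snd := by fun_prop
  have y1 := (cfst.tendsto x).comp hy
  have y2 := (csnd.tendsto x).comp hy
  refine ⟨⟨fun k => (y k).fst, fun k => (w k).fst, fun k ε hε => ?_, y1,
      (hf.tendsto _).comp y1, (cfst.tendsto H).comp hlim⟩,
    ⟨fun k => (y k).snd, fun k => (w k).snd, fun k ε hε => ?_, y2,
      (hg.tendsto _).comp y2, (csnd.tendsto H).comp hlim⟩⟩
  · have hc : Tendsto (fun a : E => (WithLp.toLp 2 (a, (y k).snd) : WithLp 2 (E × F)))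
        (𝓝 (y k).fst) (𝓝 (y k)) :=
      Continuous.tendsto (f := fun a : E => (WithLp.toLp 2 (a, (y k).snd) : WithLp 2 (E × F)))
        (by fun_prop) (y k).fst
    filter_upwards [hc.eventually (hw k ε hε)] with a ha
    rw [WithLp.prod_inner_apply, WithLp.prod_norm_eq_of_L2] at ha
    simp at ha
    linarith
  · have hc : Tendsto (fun b : F => (WithLp.toLp 2 ((y k).fst, b) : WithLp 2 (E × F)))
        (𝓝 (y k).snd) (𝓝 (y k)) :=
      Continuous.tendsto (f := fun b : F => (WithLp.toLp 2 ((y k).fst, b) : WithLp 2 (E × F)))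
        (by fun_prop) (y k).snd
    filter_upwards [hc.eventually (hw k ε hε)] with a ha
    rw [WithLp.prod_inner_apply, WithLp.prod_norm_eq_of_L2] at ha
    simpa [add_assoc, add_sub_assoc] using ha

theorem normalCone_prod {A : Set E} {B : Set F} {x u : WithLp 2 (E × F)}
    (hu : u ∈ normalCone {p : WithLp 2 (E × F) | p.fst ∈ A ∧ p.snd ∈ B} x) :
    u.fst ∈ normalCone A x.fst ∧ u.snd ∈ normalCone B x.snd := by
  obtain ⟨y, w, hyC, hw, hy, hlim⟩ := hu
  have cfst : Continuous fun p : WithLp 2 (E × F) => p.fst := by fun_prop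
  have csnd : Continuous fun p : WithLp 2 (E × F) => p.snd := by fun_prop
  refine ⟨⟨fun k => (y k).fst, fun k => (w k).fst, fun k => (hyC k).1, fun k ε hε => ?_,
      (cfst.tendsto x).comp hy, (cfst.tendsto u).comp hlim⟩,
    ⟨fun k => (y k).snd, fun k => (w k).snd, fun k => (hyC k).2, fun k ε hε => ?_,
      (csnd.tendsto x).comp hy, (csnd.tendsto u).comp hlim⟩⟩
  · have hc : Tendsto (fun a : E => (WithLp.toLp 2 (a, (y k).snd) : WithLp 2 (E × F)))
        (𝓝[A] (y k).fst) (𝓝[{p : WithLp 2 (E × F) | p.fst ∈ A ∧ p.snd ∈ B}] (y k)) := by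
      refine tendsto_nhdsWithin_of_tendsto_nhds_of_eventually_within _ ?_ ?_
      · exact (Continuous.tendsto
          (f := fun a : E => (WithLp.toLp 2 (a, (y k).snd) : WithLp 2 (E × F)))
          (by fun_prop) (y k).fst).mono_left nhdsWithin_le_nhds
      · filter_upwards [self_mem_nhdsWithin] with a ha using ⟨ha, (hyC k).2⟩
    filter_upwards [hc.eventually (hw k ε hε)] with a ha
    rw [WithLp.prod_inner_apply, WithLp.prod_norm_eq_of_L2] at ha
    simpa using ha
  · have hc : Tendsto (fun b : F => (WithLp.toLp 2 ((y k).fst, b) : WithLp 2 (E × F)))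
        (𝓝[B] (y k).snd) (𝓝[{p : WithLp 2 (E × F) | p.fst ∈ A ∧ p.snd ∈ B}] (y k)) := by
      refine tendsto_nhdsWithin_of_tendsto_nhds_of_eventually_within _ ?_ ?_
      · exact (Continuous.tendsto
          (f := fun b : F => (WithLp.toLp 2 ((y k).fst, b) : WithLp 2 (E × F)))
          (by fun_prop) (y k).snd).mono_left nhdsWithin_le_nhds
      · filter_upwards [self_mem_nhdsWithin] with a ha using ⟨(hyC k).1, ha⟩
    filter_upwards [hc.eventually (hw k ε hε)] with a ha
    rw [WithLp.prod_inner_apply, WithLp.prod_norm_eq_of_L2] at ha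
    simpa using ha

end Subgradients

/-! ### A multiplier rule for composite minimization -/

section Multiplier

variable {E F : Type*} [NormedAddCommGroup E] [InnerProductSpace ℝ E] [FiniteDimensional ℝ E]
  [NormedAddCommGroup F] [InnerProductSpace ℝ F] [FiniteDimensional ℝ F]

open ContinuousLinearMap in
/-- Approximate multipliers. The composition `f ∘ G` is decoupled: for a large penalty `c`, the
function `f z + c ‖z - G x‖² + ‖x - x₀‖²` is minimized over `x ∈ C` and `z` near `(x₀, G x₀)`.
The optimality condition in `z` yields a regular subgradient of `f`, the one in `x` a regular
normal to `C`; the Lipschitz constant of `f` bounds the subgradient. -/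
theorem exists_approx_multiplier {f : F → ℝ} (hf : LocallyLipschitz f) {G : E → F}
    {G' : E → E →L[ℝ] F} (hG : ∀ x, HasFDerivAt G (G' x) x) {C : Set E} (hC : IsClosed C)
    {x₀ : E} (hx₀ : x₀ ∈ C) (hmin : ∀ x ∈ C, f (G x₀) ≤ f (G x)) :
    ∃ M : ℝ, ∀ ε : ℝ, 0 < ε → ∃ x ∈ C, ∃ z, ∃ w ∈ regularSubdiff f z,
      ‖x - x₀‖ < ε ∧ ‖z - G x₀‖ < ε ∧ ‖w‖ ≤ M ∧
      -(adjoint (G' x) w) - (2 : ℝ) • (x - x₀) ∈ regularNormalCone C x := by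
  have hGc : Continuous G := continuous_iff_continuousAt.2 fun x => (hG x).continuousAt
  obtain ⟨K, t, ht, hK⟩ := hf (G x₀)
  obtain ⟨δ, hδ, hδt⟩ := Metric.nhds_basis_closedBall.mem_iff.1 ht
  obtain ⟨ρ, hρ, hρG⟩ := Metric.nhds_basis_closedBall.mem_iff.1
    (hGc.continuousAt.preimage_mem_nhds (Metric.closedBall_mem_nhds (G x₀) hδ))
  refine ⟨2 * K, fun ε hε => ?_⟩
  have hεδ : 0 < min ε δ / 2 := by positivity
  obtain ⟨ε₁, hε₁, hε₁G⟩ := Metric.nhds_basis_ball.mem_iff.1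
    (hGc.continuousAt.preimage_mem_nhds (Metric.ball_mem_nhds (G x₀) hεδ))
  set ε₂ := min ε₁ (min ε ρ) with hε₂
  have hε₂pos : 0 < ε₂ := by positivity
  obtain ⟨c, hc0, hc1, hc2⟩ : ∃ c : ℝ, 0 < c ∧ (K : ℝ) / c < min ε δ / 2 ∧
      (K : ℝ) * K / c < ε₂ ^ 2 := by
    have h1 : Tendsto (fun c : ℝ => (K : ℝ) / c) atTop (𝓝 0) :=
      tendsto_const_nhds.div_atTop tendsto_id
    have h2 : Tendsto (fun c : ℝ => (K : ℝ) * K / c) atTop (𝓝 0) :=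
      tendsto_const_nhds.div_atTop tendsto_id
    exact ((eventually_gt_atTop 0).and ((h1.eventually (gt_mem_nhds hεδ)).and
      (h2.eventually (gt_mem_nhds (by positivity))))).exists
  let φ : E × F → ℝ := fun p => f p.2 + (c * ‖p.2 - G p.1‖ ^ 2 + ‖p.1 - x₀‖ ^ 2)
  have hφ : Continuous φ := by
    have := hf.continuous
    fun_prop
  have hcomp : IsCompact ((C ∩ Metric.closedBall x₀ ρ) ×ˢ Metric.closedBall (G x₀) δ) :=
    ((isCompact_closedBall x₀ ρ).inter_left hC).prod (isCompact_closedBall _ _)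
  obtain ⟨⟨x, z⟩, ⟨⟨hxC, hxρ⟩, hzδ⟩, hxz⟩ := hcomp.exists_isMinOn
    ⟨(x₀, G x₀), ⟨hx₀, Metric.mem_closedBall_self hρ.le⟩, Metric.mem_closedBall_self hδ.le⟩
    hφ.continuousOn
  set a := ‖z - G x‖ with ha
  set b := ‖x - x₀‖ with hb
  -- compare with the value at `(x₀, G x₀)`: the loss in `f` along `z - G x` is at most `K * a`
  have hab : c * a ^ 2 + b ^ 2 ≤ K * a := by
    have h1 : φ (x, z) ≤ φ (x₀, G x₀) :=
      hxz (show (x₀, G x₀) ∈ (C ∩ Metric.closedBall x₀ ρ) ×ˢ Metric.closedBall (G x₀) δ from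
        ⟨⟨hx₀, Metric.mem_closedBall_self hρ.le⟩, Metric.mem_closedBall_self hδ.le⟩)
    have h2 := hmin x hxC
    have h3 := hK.dist_le_mul _ (hδt (hρG hxρ)) _ (hδt hzδ)
    rw [Real.dist_eq, dist_comm, dist_eq_norm, ← ha] at h3
    have h4 := (abs_le.1 h3).2
    simp only [φ, sub_self, norm_zero] at h1
    rw [← ha, ← hb] at h1
    linarith
  have ha0 : 0 ≤ a := norm_nonneg _
  have hb0 : 0 ≤ b := norm_nonneg _
  have hca : c * a ≤ K := by
    rcases ha0.eq_or_lt with h | h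
    · rw [← h]; simp
    · have : c * a * a ≤ K * a := by nlinarith
      exact le_of_mul_le_mul_right this h
  have haK : a ≤ K / c := by rwa [le_div_iff₀ hc0, mul_comm]
  have hbε : b < ε₂ := by
    refine lt_of_pow_lt_pow_left₀ 2 hε₂pos.le (lt_of_le_of_lt ?_ hc2)
    have h1 : b ^ 2 ≤ K * a := by nlinarith [mul_nonneg hc0.le (sq_nonneg a)]
    calc b ^ 2 ≤ K * a := h1
      _ ≤ K * (K / c) := by gcongr
      _ = K * K / c := by ring
  have hGx : ‖G x - G x₀‖ < min ε δ / 2 := by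
    have : x ∈ Metric.ball x₀ ε₁ := by
      rw [mem_ball_iff_norm]; exact hbε.trans_le (min_le_left _ _)
    exact mem_ball_iff_norm.1 (hε₁G this)
  have hz : ‖z - G x₀‖ < min ε δ := by
    have : z - G x₀ = (z - G x) + (G x - G x₀) := by abel
    rw [this]
    refine (norm_add_le _ _).trans_lt ?_
    rw [← ha]
    linarith
  -- the subgradient is minus the gradient of the penalty in `z`, of norm `2 * c * a ≤ 2 * K`
  refine ⟨x, hxC, z, (-(2 * c)) • (z - G x), ?_, hbε.trans_le ((min_le_right _ _).trans
    (min_le_left _ _)), hz.trans_le (min_le_left _ _), ?_, ?_⟩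
  · have hd : HasFDerivAt (fun y => c * ‖y - G x‖ ^ 2)
        (c • (2 • (innerSL ℝ (z - G x)).comp (ContinuousLinearMap.id ℝ F))) z :=
      (((hasFDerivAt_id z).sub_const (G x)).norm_sq).const_mul c
    refine mem_regularSubdiff_of_isLocalMin hd ?_ fun h => ?_
    · have : Metric.closedBall (G x₀) δ ∈ 𝓝 z :=
        mem_of_superset (Metric.isOpen_ball.mem_nhds
          (mem_ball_iff_norm.2 (hz.trans_le (min_le_right _ _)))) Metric.ball_subset_closedBall
      filter_upwards [this] with y hy
      have h1 : φ (x, z) ≤ φ (x, y) := hxz ⟨⟨hxC, hxρ⟩, hy⟩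
      simp only [φ] at h1
      linarith
    · rw [inner_smul_left, inner_sub_left]
      simp
      ring
  · rw [norm_smul, norm_neg, Real.norm_eq_abs, abs_of_pos (by positivity), ← ha]
    linarith
  · have hd : HasFDerivAt (fun y => c * ‖z - G y‖ ^ 2 + ‖y - x₀‖ ^ 2)
        (c • (2 • (innerSL ℝ (z - G x)).comp (-(G' x))) +
          2 • (innerSL ℝ (x - x₀)).comp (ContinuousLinearMap.id ℝ E)) x :=
      ((((hG x).const_sub z).norm_sq).const_mul c).add
        (((hasFDerivAt_id x).sub_const x₀).norm_sq)
    refine mem_regularNormalCone_of_isLocalMinOn hd ?_ fun h => ?_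
    · have : Metric.closedBall x₀ ρ ∈ 𝓝[C] x :=
        nhdsWithin_le_nhds (mem_of_superset (Metric.isOpen_ball.mem_nhds
          (mem_ball_iff_norm.2 (hbε.trans_le ((min_le_right _ _).trans (min_le_right _ _)))))
          Metric.ball_subset_closedBall)
      filter_upwards [this, self_mem_nhdsWithin] with y hy hyC
      have h1 : φ (x, z) ≤ φ (y, z) := hxz ⟨⟨hyC, hy⟩, hzδ⟩
      simp only [φ] at h1
      linarith
    · simp only [inner_sub_left, inner_neg_left, adjoint_inner_left, inner_smul_left]
      simp
      ring

theorem tendsto_adjoint_apply {A : ℕ → E →L[ℝ] F} {A₀ : E →L[ℝ] F} {w : ℕ → F} {H : F}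
    (hA : Tendsto A atTop (𝓝 A₀)) (hw : Tendsto w atTop (𝓝 H)) :
    Tendsto (fun k => ContinuousLinearMap.adjoint (A k) (w k)) atTop
      (𝓝 (ContinuousLinearMap.adjoint A₀ H)) := by
  have h : Continuous (ContinuousLinearMap.adjoint (𝕜 := ℝ) (E := E) (F := F)) :=
    LinearIsometryEquiv.continuous _
  generalize ContinuousLinearMap.adjoint (𝕜 := ℝ) (E := E) (F := F) = T at *
  have h' : Continuous fun p : (F →L[ℝ] E) × F => p.1 p.2 :=
    isBoundedBilinearMap_apply.continuous
  exact (h'.tendsto (T A₀, H)).comp (((h.tendsto A₀).comp hA).prodMk_nhds hw)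

open ContinuousLinearMap in
/-- First-order condition for minimizing `f ∘ G` over a closed set `C`, with `f` locally Lipschitz
and `G` continuously differentiable: a limiting subgradient `H` of `f` at `G x₀` exists with
`-(DG x₀)ᵀ H` normal to `C` at `x₀`. -/
theorem exists_multiplier {f : F → ℝ} (hf : LocallyLipschitz f) {G : E → F}
    {G' : E → E →L[ℝ] F} (hG : ∀ x, HasFDerivAt G (G' x) x) (hG' : Continuous G')
    {C : Set E} (hC : IsClosed C)
    {x₀ : E} (hx₀ : x₀ ∈ C) (hmin : ∀ x ∈ C, f (G x₀) ≤ f (G x)) :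
    ∃ H ∈ limitingSubdiff f (G x₀), -(adjoint (G' x₀) H) ∈ normalCone C x₀ := by
  obtain ⟨M, hM⟩ := exists_approx_multiplier hf hG hC hx₀ hmin
  choose x hxC z w hw hx hz hwM hN using fun k : ℕ => hM (1 / ((k : ℝ) + 1)) (by positivity)
  have hx' : Tendsto x atTop (𝓝 x₀) :=
    tendsto_iff_norm_sub_tendsto_zero.2 (squeeze_zero (fun _ => norm_nonneg _)
      (fun k => (hx k).le) tendsto_one_div_add_atTop_nhds_zero_nat)
  have hz' : Tendsto z atTop (𝓝 (G x₀)) :=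
    tendsto_iff_norm_sub_tendsto_zero.2 (squeeze_zero (fun _ => norm_nonneg _)
      (fun k => (hz k).le) tendsto_one_div_add_atTop_nhds_zero_nat)
  obtain ⟨H, -, φ, hφ, hH⟩ := (isCompact_closedBall (0 : F) M).tendsto_subseq
    (x := w) fun k => by simpa using hwM k
  have hφ' := hφ.tendsto_atTop
  have hx'' : Tendsto (fun k => x (φ k)) atTop (𝓝 x₀) := hx'.comp hφ'
  have hz'' : Tendsto (fun k => z (φ k)) atTop (𝓝 (G x₀)) := hz'.comp hφ'
  have h2 : Tendsto (fun k => G' (x (φ k))) atTop (𝓝 (G' x₀)) := (hG'.tendsto x₀).comp hx''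
  have h1 := tendsto_adjoint_apply h2 hH
  have h4 : Tendsto (fun k => (2 : ℝ) • (x (φ k) - x₀)) atTop (𝓝 ((2 : ℝ) • (x₀ - x₀))) :=
    (hx''.sub_const x₀).const_smul 2
  have h5 : Tendsto (fun k => -(adjoint (G' (x (φ k))) (w (φ k))) - (2 : ℝ) • (x (φ k) - x₀)) atTop
      (𝓝 (-(adjoint (G' x₀) H))) := by
    simpa using h1.neg.sub h4
  exact ⟨H, ⟨fun k => z (φ k), fun k => w (φ k), fun k => hw (φ k), hz'',
    (hf.continuous.tendsto _).comp hz'', hH⟩,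
    ⟨fun k => x (φ k), _, fun k => hxC (φ k), fun k => hN (φ k), hx'', h5⟩⟩

end Multiplier

/-! ### Matrix products and the factorized problem -/

section Factorization

variable {m n d : ℕ}

theorem inner_mulT_left (H : Mat m n) (U : Mat m d) (Y : Mat n d) :
    inner ℝ H (mulT U Y) = inner ℝ (mul H Y) U := by
  simp only [mulT, mul, PiLp.inner_apply, RCLike.inner_apply, conj_trivial, Fintype.sum_prod_type,
    Finset.sum_mul, Finset.mul_sum]
  refine Finset.sum_congr rfl fun i _ => ?_
  rw [Finset.sum_comm]
  exact Finset.sum_congr rfl fun k _ => Finset.sum_congr rfl fun j _ => by ring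

theorem inner_mulT_right (H : Mat m n) (X : Mat m d) (V : Mat n d) :
    inner ℝ H (mulT X V) = inner ℝ (tmul H X) V := by
  simp only [mulT, tmul, PiLp.inner_apply, RCLike.inner_apply, conj_trivial,
    Fintype.sum_prod_type, Finset.sum_mul, Finset.mul_sum]
  rw [Finset.sum_comm]
  refine Finset.sum_congr rfl fun j _ => ?_
  rw [Finset.sum_comm]
  exact Finset.sum_congr rfl fun k _ => Finset.sum_congr rfl fun i _ => by ring

theorem mulT_add_smul_left (X U : Mat m d) (Y : Mat n d) (t : ℝ) :
    mulT (X + t • U) Y = mulT X Y + t • mulT U Y := by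
  ext e
  simp only [mulT, PiLp.add_apply, PiLp.smul_apply, smul_eq_mul, add_mul, Finset.sum_add_distrib,
    Finset.mul_sum, mul_assoc]

theorem mulT_add_smul_right (X : Mat m d) (Y V : Mat n d) (t : ℝ) :
    mulT X (Y + t • V) = mulT X Y + t • mulT X V := by
  ext e
  simp only [mulT, PiLp.add_apply, PiLp.smul_apply, smul_eq_mul, mul_add, Finset.sum_add_distrib,
    Finset.mul_sum, mul_left_comm]

theorem contDiff_mulT : ContDiff ℝ 1 fun p : Mat m d × Mat n d => mulT p.1 p.2 := by
  refine contDiff_euclidean.2 fun e => ?_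
  simp only [mulT]
  fun_prop

theorem fderiv_apply_of_affine {E F : Type*} [NormedAddCommGroup E] [NormedSpace ℝ E]
    [NormedAddCommGroup F] [NormedSpace ℝ F] {G : E → F} {x h : E} {v : F}
    (hG : DifferentiableAt ℝ G x) (ha : ∀ t : ℝ, G (x + t • h) = G x + t • v) :
    fderiv ℝ G x h = v := by
  have h1 : HasLineDerivAt ℝ G (fderiv ℝ G x h) x h := hG.hasFDerivAt.hasLineDerivAt h
  have h2 : HasLineDerivAt ℝ G v x h := by
    rw [HasLineDerivAt]
    simp only [ha]
    simpa using ((hasDerivAt_id (0 : ℝ)).smul_const v).const_add (G x)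
  exact h1.unique h2

/-- First-order condition for minimizing `f (X Yᵀ) S + g S` over a product of closed sets. The
term `g` receives its own copy of `S`, so that the composite multiplier rule applies to
`f Z T + g U` along `(Z, T, U) = (X Yᵀ, S, S)`. -/
theorem exists_factorization_multiplier {f : Mat m n → Mat m n → ℝ} {g : Mat m n → ℝ}
    (hf : LocallyLipschitz fun p : Mat m n × Mat m n => f p.1 p.2) (hg : LocallyLipschitz g)
    {A : Set (Mat m d)} {B : Set (Mat n d)} {D : Set (Mat m n)}
    (hA : IsClosed A) (hB : IsClosed B) (hD : IsClosed D) {X : Mat m d} {Y : Mat n d} {S : Mat m n}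
    (hX : X ∈ A) (hY : Y ∈ B) (hS : S ∈ D)
    (hmin : ∀ X' ∈ A, ∀ Y' ∈ B, ∀ S' ∈ D, f (mulT X Y) S + g S ≤ f (mulT X' Y') S' + g S') :
    ∃ H : Mat m n × Mat m n, WithLp.toLp 2 H ∈
        limitingSubdiff (fun p : WithLp 2 (Mat m n × Mat m n) => f p.fst p.snd)
          (WithLp.toLp 2 (mulT X Y, S)) ∧
      ∃ Q ∈ limitingSubdiff g S, -(mul H.1 Y) ∈ normalCone A X ∧
        -(tmul H.1 X) ∈ normalCone B Y ∧ -H.2 - Q ∈ normalCone D S := by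
  let E := WithLp 2 (Mat m d × WithLp 2 (Mat n d × Mat m n))
  let L := WithLp 2 (Mat m n × Mat m n)
  let F := WithLp 2 (L × Mat m n)
  let G : E → F := fun p =>
    WithLp.toLp 2 (WithLp.toLp 2 (mulT p.fst p.snd.fst, p.snd.snd), p.snd.snd)
  let f₁ : L → ℝ := fun p => f p.fst p.snd
  have hf₁ : LocallyLipschitz f₁ :=
    hf.comp (WithLp.prod_lipschitzWith_ofLp 2 (Mat m n) (Mat m n)).locallyLipschitz
  have hF : LocallyLipschitz fun p : F => f₁ p.fst + g p.snd :=
    (contDiff_add (𝕜 := ℝ) (F := ℝ) (n := 1)).locallyLipschitz.comp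
      ((hf₁.comp (LipschitzWith.prod_fst.comp
        (WithLp.prod_lipschitzWith_ofLp 2 L (Mat m n))).locallyLipschitz).prodMk
      (hg.comp (LipschitzWith.prod_snd.comp
        (WithLp.prod_lipschitzWith_ofLp 2 L (Mat m n))).locallyLipschitz))
  have c₁ : ContDiff ℝ 1 fun p : E => p.fst :=
    contDiff_fst.comp (WithLp.prodContinuousLinearEquiv 2 ℝ (Mat m d)
      (WithLp 2 (Mat n d × Mat m n))).contDiff
  have c₂ : ContDiff ℝ 1 fun p : E => p.snd :=
    contDiff_snd.comp (WithLp.prodContinuousLinearEquiv 2 ℝ (Mat m d)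
      (WithLp 2 (Mat n d × Mat m n))).contDiff
  have c₃ : ContDiff ℝ 1 fun p : E => p.snd.fst :=
    (contDiff_fst.comp (WithLp.prodContinuousLinearEquiv 2 ℝ (Mat n d) (Mat m n)).contDiff).comp c₂
  have c₄ : ContDiff ℝ 1 fun p : E => p.snd.snd :=
    (contDiff_snd.comp (WithLp.prodContinuousLinearEquiv 2 ℝ (Mat n d) (Mat m n)).contDiff).comp c₂
  have hG : ContDiff ℝ 1 G :=
    (WithLp.prodContinuousLinearEquiv 2 ℝ L (Mat m n)).symm.contDiff.comp
      (((WithLp.prodContinuousLinearEquiv 2 ℝ (Mat m n) (Mat m n)).symm.contDiff.comp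
        ((contDiff_mulT.comp (c₁.prodMk c₃)).prodMk c₄)).prodMk c₄)
  let C : Set E := {p | p.fst ∈ A ∧ p.snd ∈ {q : WithLp 2 (Mat n d × Mat m n) |
    q.fst ∈ B ∧ q.snd ∈ D}}
  have hC : IsClosed C := (hA.preimage c₁.continuous).inter
    ((hB.preimage c₃.continuous).inter (hD.preimage c₄.continuous))
  let x : E := WithLp.toLp 2 (X, WithLp.toLp 2 (Y, S))
  have hGd : ∀ x, HasFDerivAt G (fderiv ℝ G x) x := fun x =>
    (hG.differentiable one_ne_zero x).hasFDerivAt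
  obtain ⟨H, hH, hN⟩ := exists_multiplier hF hGd (hG.continuous_fderiv one_ne_zero) hC
    (x₀ := x) ⟨hX, hY, hS⟩ fun p hp => hmin _ hp.1 _ hp.2.1 _ hp.2.2
  obtain ⟨h1, h2⟩ := limitingSubdiff_separable hf₁.continuous hg.continuous hH
  obtain ⟨hNX, hN'⟩ := normalCone_prod hN
  obtain ⟨hNY, hNS⟩ := normalCone_prod hN'
  set u := -(ContinuousLinearMap.adjoint (fderiv ℝ G x) H) with hu
  -- `G` is only evaluated along directions in which it is affine, so no derivative of the product
  -- has to be computed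
  have key : ∀ (U : Mat m d) (V : Mat n d) (T Z : Mat m n),
      (∀ t : ℝ, mulT (X + t • U) (Y + t • V) = mulT X Y + t • Z) →
      inner ℝ u.fst U + (inner ℝ u.snd.fst V + inner ℝ u.snd.snd T) =
        -(inner ℝ H.fst.fst Z + inner ℝ H.fst.snd T + inner ℝ H.snd T) := fun U V T Z hZ => by
    let h : E := WithLp.toLp 2 (U, WithLp.toLp 2 (V, T))
    let v : F := WithLp.toLp 2 (WithLp.toLp 2 (Z, T), T)
    have hv : ∀ t : ℝ, G (x + t • h) = G x + t • v := fun t =>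
      congrArg (fun Z' : Mat m n =>
        (WithLp.toLp 2 (WithLp.toLp 2 (Z', S + t • T), S + t • T) : F)) (hZ t)
    have h1 : inner ℝ u h = -inner ℝ H v := by
      rw [hu, inner_neg_left, ContinuousLinearMap.adjoint_inner_left,
        fderiv_apply_of_affine (hG.differentiable one_ne_zero x) hv]
    rw [WithLp.prod_inner_apply, WithLp.prod_inner_apply, WithLp.prod_inner_apply,
      WithLp.prod_inner_apply] at h1
    exact h1
  refine ⟨(H.fst.fst, H.fst.snd), h1, H.snd, h2, ?_, ?_, ?_⟩
  · suffices h : -(mul H.fst.fst Y) = u.fst from h ▸ hNX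
    refine ext_inner_right ℝ fun U => ?_
    have := key U 0 0 (mulT U Y) fun t => by rw [smul_zero, add_zero, mulT_add_smul_left]
    rw [inner_neg_left, ← inner_mulT_left]
    simpa only [inner_zero_right, add_zero] using this.symm
  · suffices h : -(tmul H.fst.fst X) = u.snd.fst from h ▸ hNY
    refine ext_inner_right ℝ fun V => ?_
    have := key 0 V 0 (mulT X V) fun t => by rw [smul_zero, add_zero, mulT_add_smul_right]
    rw [inner_neg_left, ← inner_mulT_right]
    simpa only [inner_zero_right, add_zero, zero_add] using this.symm
  · suffices h : -H.fst.snd - H.snd = u.snd.snd from h ▸ hNS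
    refine ext_inner_right ℝ fun T => ?_
    have := key 0 0 T 0 fun t => by simp only [smul_zero, add_zero]
    rw [inner_sub_left, inner_neg_left]
    simp only [inner_zero_right, zero_add] at this
    linarith

end Factorization

/-! ### Restriction to a set of entries -/

section Restriction

variable {p q : ℕ}

theorem restrictCols_eq_restrictEntries (I : Set (Fin q)) :
    (restrictCols I : Mat p q → Mat p q) = restrictEntries {e | e.2 ∈ I} := rfl

theorem restrictEntries_apply_of_mem {J : Set (Fin p × Fin q)} {e : Fin p × Fin q} (h : e ∈ J)
    (U : Mat p q) : restrictEntries J U e = U e := by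
  simp [restrictEntries, h]

theorem restrictEntries_apply_of_notMem {J : Set (Fin p × Fin q)} {e : Fin p × Fin q} (h : e ∉ J)
    (U : Mat p q) : restrictEntries J U e = 0 := by
  simp [restrictEntries, h]

theorem restrictEntries_eq_self_iff {J : Set (Fin p × Fin q)} {U : Mat p q} :
    restrictEntries J U = U ↔ ∀ e ∉ J, U e = 0 := by
  refine ⟨fun h e he => by rw [← h, restrictEntries_apply_of_notMem he], fun h => ?_⟩
  ext e
  by_cases he : e ∈ J
  · rw [restrictEntries_apply_of_mem he]
  · rw [restrictEntries_apply_of_notMem he, h e he]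

theorem restrictEntries_idem (J : Set (Fin p × Fin q)) (U : Mat p q) :
    restrictEntries J (restrictEntries J U) = restrictEntries J U :=
  restrictEntries_eq_self_iff.2 fun _ he => restrictEntries_apply_of_notMem he U

theorem restrictEntries_sub (J : Set (Fin p × Fin q)) (U V : Mat p q) :
    restrictEntries J (U - V) = restrictEntries J U - restrictEntries J V := by
  ext e
  by_cases he : e ∈ J <;> simp [restrictEntries, he]

theorem inner_restrictEntries_left (J : Set (Fin p × Fin q)) (U V : Mat p q) :
    inner ℝ (restrictEntries J U) V = inner ℝ U (restrictEntries J V) := by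
  simp only [PiLp.inner_apply]
  refine Finset.sum_congr rfl fun e _ => ?_
  by_cases he : e ∈ J <;> simp [restrictEntries, he]

theorem norm_restrictEntries_le (J : Set (Fin p × Fin q)) (U : Mat p q) :
    ‖restrictEntries J U‖ ≤ ‖U‖ := by
  rw [EuclideanSpace.norm_eq, EuclideanSpace.norm_eq]
  refine Real.sqrt_le_sqrt (Finset.sum_le_sum fun e _ => ?_)
  by_cases he : e ∈ J
  · rw [restrictEntries_apply_of_mem he]
  · rw [restrictEntries_apply_of_notMem he, norm_zero]
    exact pow_le_pow_left₀ le_rfl (norm_nonneg _) 2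

theorem continuous_restrictEntries (J : Set (Fin p × Fin q)) :
    Continuous (restrictEntries J) := by
  refine (PiLp.continuous_toLp 2 _).comp (continuous_pi fun e => ?_)
  by_cases he : e ∈ J
  · simp only [he, if_true]; fun_prop
  · simp only [he, if_false]; fun_prop

theorem inner_eq_of_restrictEntries_eq {J : Set (Fin p × Fin q)} {u w v : Mat p q}
    (h : restrictEntries J u = restrictEntries J w) (hv : restrictEntries J v = v) :
    inner ℝ u v = inner ℝ w v := by
  rw [← hv, ← inner_restrictEntries_left, ← inner_restrictEntries_left, h]

/-- The set `C` is a product with respect to the splitting of the entries into `J` and its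
complement, and contains the origin. -/
structure SplitsAlong (C : Set (Mat p q)) (J : Set (Fin p × Fin q)) : Prop where
  zero_mem : (0 : Mat p q) ∈ C
  glue : ∀ y ∈ C, ∀ z ∈ C, restrictEntries J y + (z - restrictEntries J z) ∈ C

theorem SplitsAlong.restrict_mem {C : Set (Mat p q)} {J : Set (Fin p × Fin q)}
    (hC : SplitsAlong C J) {y : Mat p q} (hy : y ∈ C) : restrictEntries J y ∈ C := by
  have := hC.glue y hy 0 hC.zero_mem
  rwa [restrictEntries_eq_self_iff.2 (fun _ _ => rfl : ∀ e ∉ J, (0 : Mat p q) e = 0), sub_self,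
    add_zero] at this

theorem SplitsAlong.mem_image_iff {C : Set (Mat p q)} {J : Set (Fin p × Fin q)}
    (hC : SplitsAlong C J) {y : Mat p q} :
    y ∈ restrictEntries J '' C ↔ y ∈ C ∧ restrictEntries J y = y := by
  refine ⟨?_, fun h => ⟨y, h⟩⟩
  rintro ⟨z, hz, rfl⟩
  exact ⟨hC.restrict_mem hz, restrictEntries_idem J z⟩

theorem SplitsAlong.isClosed_image {C : Set (Mat p q)} {J : Set (Fin p × Fin q)}
    (hC : SplitsAlong C J) (hcl : IsClosed C) : IsClosed (restrictEntries J '' C) := by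
  have : restrictEntries J '' C = C ∩ {y | restrictEntries J y = y} := by
    ext y; exact hC.mem_image_iff
  rw [this]
  exact hcl.inter (isClosed_eq (continuous_restrictEntries J) continuous_id)

/-- Restricting a normal vector to the restricted set gives a normal vector to the whole set. -/
theorem SplitsAlong.restrict_mem_normalCone {C : Set (Mat p q)} {J : Set (Fin p × Fin q)}
    (hC : SplitsAlong C J) {x w : Mat p q} (hw : w ∈ normalCone (restrictEntries J '' C) x) :
    restrictEntries J w ∈ normalCone C x := by
  obtain ⟨y, u, hy, hu, hyx, huw⟩ := hw
  refine ⟨y, fun k => restrictEntries J (u k), fun k => (hC.mem_image_iff.1 (hy k)).1,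
    fun k ε hε => ?_, hyx, ((continuous_restrictEntries J).tendsto w).comp huw⟩
  have hyk := (hC.mem_image_iff.1 (hy k)).2
  have hc : Tendsto (restrictEntries J) (𝓝[C] (y k)) (𝓝[restrictEntries J '' C] (y k)) := by
    refine tendsto_nhdsWithin_of_tendsto_nhds_of_eventually_within _ ?_ ?_
    · have := ((continuous_restrictEntries J).tendsto (y k))
      rw [hyk] at this
      exact this.mono_left nhdsWithin_le_nhds
    · filter_upwards [self_mem_nhdsWithin] with z hz using mem_image_of_mem _ hz
  filter_upwards [hc.eventually (hu k ε hε)] with z hz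
  rw [inner_restrictEntries_left, restrictEntries_sub, hyk]
  refine hz.trans (mul_le_mul_of_nonneg_left ?_ hε.le)
  have := norm_restrictEntries_le J (z - y k)
  rwa [restrictEntries_sub, hyk] at this

/-- A normal vector to the whole set is normal to the restricted set, where moreover its entries
outside `J` are arbitrary. -/
theorem SplitsAlong.mem_normalCone_image {C : Set (Mat p q)} {J : Set (Fin p × Fin q)}
    (hC : SplitsAlong C J) {x w u : Mat p q} (hw : w ∈ normalCone C x)
    (hx : restrictEntries J x = x) (hu : restrictEntries J u = restrictEntries J w) :
    u ∈ normalCone (restrictEntries J '' C) x := by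
  obtain ⟨y, v, hy, hv, hyx, hvw⟩ := hw
  refine ⟨fun k => restrictEntries J (y k), fun k => v k + (u - w),
    fun k => mem_image_of_mem _ (hy k), fun k ε hε => ?_, ?_, ?_⟩
  · have hc : Tendsto (fun z => z + (y k - restrictEntries J (y k)))
        (𝓝[restrictEntries J '' C] (restrictEntries J (y k))) (𝓝[C] (y k)) := by
      refine tendsto_nhdsWithin_of_tendsto_nhds_of_eventually_within _ ?_ ?_
      · have : Continuous fun z => z + (y k - restrictEntries J (y k)) := by fun_prop
        have := this.tendsto (restrictEntries J (y k))
        rw [add_sub_cancel] at this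
        exact this.mono_left nhdsWithin_le_nhds
      · filter_upwards [self_mem_nhdsWithin] with z hz
        obtain ⟨hzC, hz⟩ := hC.mem_image_iff.1 hz
        have := hC.glue z hzC (y k) (hy k)
        rwa [hz] at this
    filter_upwards [hc.eventually (hv k ε hε), self_mem_nhdsWithin] with z hz hzJ
    have h1 : z + (y k - restrictEntries J (y k)) - y k = z - restrictEntries J (y k) := by abel
    rw [h1] at hz
    have h2 : inner ℝ (v k + (u - w)) (z - restrictEntries J (y k)) =
        inner ℝ (v k) (z - restrictEntries J (y k)) := by
      rw [inner_add_left, inner_sub_left, inner_eq_of_restrictEntries_eq hu, sub_self, add_zero]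
      rw [restrictEntries_sub, restrictEntries_idem, (hC.mem_image_iff.1 hzJ).2]
    rw [h2]
    exact hz
  · have := ((continuous_restrictEntries J).tendsto x).comp hyx
    rwa [hx] at this
  · simpa using hvw.add_const (u - w)

end Restriction

/-! ### The generator of the relaxation -/

section Generator

variable {θ₁ : ℝ → ℝ} {η : ℝ}

/-- The slope of a chord is a Clarke subgradient: by Rolle's argument, `g` minus the chord has a
local extremum `ξ`. The difference quotients in direction `v` based at `ξ`, if it is a minimum, or
at `ξ - h v`, if it is a maximum, are at least the slope times `v`. No derivative is needed. -/
theorem exists_slope_mem_clarkeSubdiff {g : ℝ → ℝ} {a b c : ℝ} (hab : a < b)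
    (hg : ContinuousOn g (Icc a b)) (hc : g b - g a = c * (b - a)) :
    ∃ ξ ∈ Ioo a b, c ∈ clarkeSubdiff g ξ := by
  obtain ⟨ξ, hξ, hext⟩ := exists_isLocalExtr_Ioo (f := fun x => g x - c * x) hab
    (hg.sub (by fun_prop)) (by linarith)
  refine ⟨ξ, hξ, fun v => ?_⟩
  have hpos : ∀ᶠ h : ℝ in 𝓝[>] 0, 0 < h := self_mem_nhdsWithin
  have hinner : inner ℝ c v = c * v := by simp [mul_comm]
  rw [hinner]
  refine le_limsup_of_frequently_le' ?_
  rcases hext with hmin | hmax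
  · have ht : Tendsto (fun h : ℝ => (ξ, h)) (𝓝[>] 0) (𝓝 ξ ×ˢ 𝓝[>] 0) :=
      tendsto_const_nhds.prodMk tendsto_id
    have hc : Tendsto (fun h : ℝ => ξ + h * v) (𝓝[>] 0) (𝓝 ξ) := by
      have : Continuous fun h : ℝ => ξ + h * v := by fun_prop
      simpa using (this.tendsto 0).mono_left nhdsWithin_le_nhds
    refine ht.frequently (Eventually.frequently ?_)
    filter_upwards [hpos, hc.eventually hmin] with h hh hm
    rw [EReal.coe_le_coe_iff, le_div_iff₀ hh, smul_eq_mul]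
    linarith
  · have hc : Tendsto (fun h : ℝ => ξ - h * v) (𝓝[>] 0) (𝓝 ξ) := by
      have : Continuous fun h : ℝ => ξ - h * v := by fun_prop
      simpa using (this.tendsto 0).mono_left nhdsWithin_le_nhds
    have ht : Tendsto (fun h : ℝ => (ξ - h * v, h)) (𝓝[>] 0) (𝓝 ξ ×ˢ 𝓝[>] 0) :=
      hc.prodMk tendsto_id
    refine ht.frequently (Eventually.frequently ?_)
    filter_upwards [hpos, hc.eventually hmax] with h hh hm
    rw [EReal.coe_le_coe_iff, le_div_iff₀ hh, smul_eq_mul, sub_add_cancel]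
    linarith

namespace IsGenerator

theorem eta_mul_le (hθ : IsGenerator θ₁ η) {t : ℝ} (h0 : 0 ≤ t) (h1 : t ≤ 1) : η * t ≤ θ₁ t := by
  rcases h0.eq_or_lt with rfl | h0
  · simp [hθ.zero]
  have hcont : ContinuousOn θ₁ (Icc 0 t) :=
    hθ.locallyLipschitzOn.continuousOn.mono Icc_subset_Ici_self
  obtain ⟨ξ, hξ, hc⟩ := exists_slope_mem_clarkeSubdiff (c := θ₁ t / t) h0 hcont
    (by rw [hθ.zero, sub_zero, sub_zero, div_mul_cancel₀ _ h0.ne'])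
  have := hθ.isGLB_eta.1 (mem_iUnion₂.2 ⟨ξ, ⟨hξ.1, hξ.2.trans_le h1⟩, hc⟩)
  rwa [le_div_iff₀ h0] at this

theorem nonneg (hθ : IsGenerator θ₁ η) {t : ℝ} (h0 : 0 ≤ t) : 0 ≤ θ₁ t := by
  rcases le_total t 1 with h1 | h1
  · exact (mul_nonneg hθ.eta_pos.le h0).trans (hθ.eta_mul_le h0 h1)
  · rcases h1.eq_or_lt with rfl | h1
    · rw [hθ.one]; exact zero_le_one
    · exact zero_le_one.trans (hθ.one_lt t h1).le

theorem theta_zero (hθ : IsGenerator θ₁ η) : theta θ₁ 0 = 0 := by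
  simp [theta, theta₂, hθ.zero]

theorem theta_of_one_le (hθ : IsGenerator θ₁ η) {t : ℝ} (ht : 1 ≤ t) : theta θ₁ t = 1 := by
  refine min_eq_right ?_
  rcases ht.eq_or_lt with rfl | ht
  · exact hθ.one.ge
  · exact (hθ.one_lt t ht).le

theorem eta_mul_le_theta (hθ : IsGenerator θ₁ η) {t : ℝ} (h0 : 0 ≤ t) (h1 : t ≤ 1) :
    η * t ≤ theta θ₁ t := by
  refine le_min (hθ.eta_mul_le h0 h1) ?_
  have := hθ.eta_mul_le zero_le_one le_rfl
  rw [hθ.one] at this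
  have := hθ.eta_pos
  simp only [theta₂]
  nlinarith

theorem theta_div_le_vartheta (hθ : IsGenerator θ₁ η) {a : ℝ} (ha : 0 ≤ a) (ρ : ℝ) :
    theta θ₁ (a / ρ) ≤ vartheta a := by
  rcases ha.eq_or_lt with rfl | ha
  · rw [zero_div, hθ.theta_zero]; simp [vartheta]
  · rw [vartheta, if_pos ha]
    exact min_le_right _ _

theorem theta_div_eq_vartheta (hθ : IsGenerator θ₁ η) {a ρ : ℝ} (ha : 0 ≤ a) (hρ : 0 < ρ)
    (haρ : a ∉ Ioo 0 ρ) :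
    theta θ₁ (a / ρ) = vartheta a := by
  rcases ha.eq_or_lt with rfl | ha
  · rw [zero_div, hθ.theta_zero]; simp [vartheta]
  · rw [vartheta, if_pos ha]
    refine hθ.theta_of_one_le ((one_le_div₀ hρ).2 ?_)
    by_contra! h
    exact haρ ⟨ha, h⟩

theorem activeIndex_eq_true_iff (hθ : IsGenerator θ₁ η) {a ρ : ℝ} (ha : 0 ≤ a) (hρ : 0 < ρ)
    (haρ : a ∉ Ioo 0 ρ) :
    activeIndex θ₁ (a / ρ) = true ↔ a ≠ 0 := by
  rw [activeIndex, decide_eq_true_iff, hθ.theta_div_eq_vartheta ha hρ haρ, theta₂, vartheta]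
  rcases ha.eq_or_lt with rfl | ha
  · simp
  · simp [ha, ha.ne']

/-- The penalty of a size in `(0, ρ)` exceeds the loss that `L`-Lipschitz continuity allows. -/
theorem mul_lt_mul_theta (hθ : IsGenerator θ₁ η) {a ρ L w : ℝ} (ha : a ∈ Ioo 0 ρ) (hw : 0 < w)
    (hL : ρ * L < w * η) :
    L * a < w * theta θ₁ (a / ρ) := by
  have hρ : 0 < ρ := ha.1.trans ha.2
  have h1 := hθ.eta_mul_le_theta (div_nonneg ha.1.le hρ.le) ((div_le_one hρ).2 ha.2.le)
  have h2 : L < w * η / ρ := by rwa [lt_div_iff₀ hρ, mul_comm]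
  calc L * a < w * η / ρ * a := mul_lt_mul_of_pos_right h2 ha.1
    _ = w * (η * (a / ρ)) := by ring
    _ ≤ w * theta θ₁ (a / ρ) := mul_le_mul_of_nonneg_left h1 hw.le

end IsGenerator

end Generator

/-! ### Columns, constraint sets and penalties -/

section Columns

variable {p q : ℕ}

theorem col_restrictCols_of_mem {I : Set (Fin q)} {k : Fin q} (hk : k ∈ I) (V : Mat p q) :
    col (restrictCols I V) k = col V k := by
  ext i
  simp [col, restrictCols, hk]

theorem col_restrictCols_of_notMem {I : Set (Fin q)} {k : Fin q} (hk : k ∉ I) (V : Mat p q) :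
    col (restrictCols I V) k = 0 := by
  ext i
  simp [col, restrictCols, hk]

theorem col_eq_zero_iff {V : Mat p q} {k : Fin q} : col V k = 0 ↔ ∀ i, V (i, k) = 0 := by
  refine ⟨fun h i => congrArg (fun v : EuclideanSpace ℝ (Fin p) => v i) h, fun h => ?_⟩
  ext i
  exact h i

theorem continuous_col (k : Fin q) : Continuous fun V : Mat p q => col V k :=
  (PiLp.continuous_toLp 2 _).comp (continuous_pi fun i => by fun_prop)

theorem sum_restrictCols_compl_singleton {g : ℝ → ℝ} (hg : g 0 = 0) (V : Mat p q) (k : Fin q) :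
    ∑ l, g ‖col (restrictCols {k}ᶜ V) l‖ = ∑ l, g ‖col V l‖ - g ‖col V k‖ := by
  have h : ∑ l, (g ‖col V l‖ - g ‖col (restrictCols {k}ᶜ V) l‖) =
      g ‖col V k‖ - g ‖col (restrictCols {k}ᶜ V) k‖ :=
    Finset.sum_eq_single k (fun l _ hl => by
      rw [col_restrictCols_of_mem (by simpa using hl), sub_self]) (by simp)
  rw [Finset.sum_sub_distrib, col_restrictCols_of_notMem (by simp), norm_zero, hg] at h
  linarith

theorem sum_restrictEntries_compl_singleton {g : ℝ → ℝ} (hg : g 0 = 0) (S : Mat p q)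
    (e : Fin p × Fin q) :
    ∑ e', g |restrictEntries {e}ᶜ S e'| = ∑ e', g |S e'| - g |S e| := by
  have h : ∑ e', (g |S e'| - g |restrictEntries {e}ᶜ S e'|) =
      g |S e| - g |restrictEntries {e}ᶜ S e| :=
    Finset.sum_eq_single e (fun l _ hl => by
      rw [restrictEntries_apply_of_mem (by simpa using hl), sub_self]) (by simp)
  rw [Finset.sum_sub_distrib, restrictEntries_apply_of_notMem (by simp), abs_zero, hg] at h
  linarith

theorem ell0_eq_sum (S : Mat p q) : ell0 S = ∑ e, vartheta |S e| :=
  (Fintype.sum_prod_type fun e => vartheta |S e|).symm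

theorem entryPenalty_eq_sum (θ₁ : ℝ → ℝ) (ρ : ℝ) (S : Mat p q) :
    entryPenalty θ₁ ρ S = ∑ e, theta θ₁ (|S e| / ρ) :=
  (Fintype.sum_prod_type fun e => theta θ₁ (|S e| / ρ)).symm

theorem entryPenaltySel_eq_sum (θ₁ : ℝ → ℝ) (ρ : ℝ) (J : Fin p → Fin q → Bool) (S : Mat p q) :
    entryPenaltySel θ₁ ρ J S = ∑ e, thetaSel θ₁ (J e.1 e.2) (|S e| / ρ) :=
  (Fintype.sum_prod_type fun e : Fin p × Fin q => thetaSel θ₁ (J e.1 e.2) (|S e| / ρ)).symm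

theorem colPenalty_restrictCols {θ₁ : ℝ → ℝ} {η : ℝ} (hθ : IsGenerator θ₁ η) (ρ : ℝ) (V : Mat p q)
    (k : Fin q) :
    colPenalty θ₁ ρ (restrictCols {k}ᶜ V) = colPenalty θ₁ ρ V - theta θ₁ (‖col V k‖ / ρ) :=
  sum_restrictCols_compl_singleton (g := fun a => theta θ₁ (a / ρ))
    (by simp only [zero_div, hθ.theta_zero]) V k

theorem entryPenalty_restrictEntries {θ₁ : ℝ → ℝ} {η : ℝ} (hθ : IsGenerator θ₁ η) (ρ : ℝ)
    (S : Mat p q) (e : Fin p × Fin q) :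
    entryPenalty θ₁ ρ (restrictEntries {e}ᶜ S) = entryPenalty θ₁ ρ S - theta θ₁ (|S e| / ρ) := by
  rw [entryPenalty_eq_sum, entryPenalty_eq_sum]
  exact sum_restrictEntries_compl_singleton (g := fun a => theta θ₁ (a / ρ))
    (by simp only [zero_div, hθ.theta_zero]) S e

theorem nnzc_restrictCols (V : Mat p q) (k : Fin q) :
    nnzc (restrictCols {k}ᶜ V) = nnzc V - vartheta ‖col V k‖ :=
  sum_restrictCols_compl_singleton (by simp [vartheta]) V k

end Columns

namespace Problem

variable {m n d : ℕ} (P : Problem m n d)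

theorem isClosed_ballSet (p : ℕ) : IsClosed (P.ballSet p) := by
  rw [ballSet, ofPred_forall]
  exact isClosed_iInter fun k =>
    isClosed_le (ENNReal.continuous_ofReal.comp (continuous_col k).norm) continuous_const

theorem isClosed_boxSet : IsClosed P.boxSet := by
  simp only [boxSet, ofPred_forall]
  refine isClosed_iInter fun i => isClosed_iInter fun j => ?_
  have h : Continuous fun S : Mat m n => ((S (i, j) : ℝ) : EReal) :=
    continuous_coe_real_ereal.comp (by fun_prop)
  exact (isClosed_le continuous_const h).inter (isClosed_le h continuous_const)

theorem splitsAlong_ballSet (p : ℕ) (I : Set (Fin d)) :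
    SplitsAlong (P.ballSet p) {e | e.2 ∈ I} where
  zero_mem := fun k => by
    have : col (0 : Mat p d) k = 0 := col_eq_zero_iff.2 fun _ => rfl
    simp [this]
  glue := fun y hy z hz k => by
    rw [← restrictCols_eq_restrictEntries]
    by_cases hk : k ∈ I
    · have : col (restrictCols I y + (z - restrictCols I z)) k = col y k := by
        ext i; simp [col, restrictCols, hk]
      rw [this]; exact hy k
    · have : col (restrictCols I y + (z - restrictCols I z)) k = col z k := by
        ext i; simp [col, restrictCols, hk]
      rw [this]; exact hz k

theorem splitsAlong_boxSet (J : Set (Fin m × Fin n)) : SplitsAlong P.boxSet J where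
  zero_mem := fun i j => ⟨P.kappa₁_nonpos i j, P.kappa₂_nonneg i j⟩
  glue := fun y hy z hz i j => by
    by_cases hk : (i, j) ∈ J
    · have : (restrictEntries J y + (z - restrictEntries J z)) (i, j) = y (i, j) := by
        simp [restrictEntries, hk]
      rw [this]; exact hy i j
    · have : (restrictEntries J y + (z - restrictEntries J z)) (i, j) = z (i, j) := by
        simp [restrictEntries, hk]
      rw [this]; exact hz i j

variable {P}

theorem restrictCols_mem_ballSet {p : ℕ} {V : Mat p d} (hV : V ∈ P.ballSet p) (I : Set (Fin d)) :
    restrictCols I V ∈ P.ballSet p :=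
  (P.splitsAlong_ballSet p I).restrict_mem hV

theorem restrictEntries_mem_boxSet {S : Mat m n} (hS : S ∈ P.boxSet) (J : Set (Fin m × Fin n)) :
    restrictEntries J S ∈ P.boxSet :=
  (P.splitsAlong_boxSet J).restrict_mem hS

end Problem

/-! ### Global minimizers -/

namespace Problem

variable {m n d : ℕ} {P : Problem m n d} {θ₁ : ℝ → ℝ} {L_X L_Y L_S η r s : ℝ}

/-- The number of nonzero columns and entries of a triple. -/
noncomputable def supportCard (W : Triple m n d) : ℕ :=
  {k | col W.1 k ≠ 0}.ncard + {k | col W.2.1 k ≠ 0}.ncard + {e | W.2.2 e ≠ 0}.ncard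

theorem ncard_restrictCols_lt {p q : ℕ} {V : Mat p q} {k : Fin q} (hk : col V k ≠ 0) :
    {l | col (restrictCols {k}ᶜ V) l ≠ 0}.ncard < {l | col V l ≠ 0}.ncard := by
  refine ncard_lt_ncard ⟨fun l hl => ?_, fun h => h hk (col_restrictCols_of_notMem (by simp) V)⟩
  by_cases hlk : l ∈ ({k}ᶜ : Set (Fin q))
  · rwa [mem_ofPred_eq, col_restrictCols_of_mem hlk] at hl
  · exact absurd (col_restrictCols_of_notMem hlk V) hl

theorem ncard_restrictEntries_lt {p q : ℕ} {S : Mat p q} {e : Fin p × Fin q} (he : S e ≠ 0) :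
    {e' | restrictEntries {e}ᶜ S e' ≠ 0}.ncard < {e' | S e' ≠ 0}.ncard := by
  refine ncard_lt_ncard
    ⟨fun l hl => ?_, fun h => h he (restrictEntries_apply_of_notMem (by simp) S)⟩
  by_cases hlk : l ∈ ({e}ᶜ : Set (Fin p × Fin q))
  · rwa [mem_ofPred_eq, restrictEntries_apply_of_mem hlk] at hl
  · exact absurd (restrictEntries_apply_of_notMem hlk S) hl

/-- A feasible point violating isolation is improved for (FR) by zeroing an offending column or
entry: its penalty outweighs the possible increase of the loss. -/
theorem exists_lt_of_not_isolated (hL : P.LipschitzOnFeasible L_X L_Y L_S)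
    (hθ : IsGenerator θ₁ η) (hrs : AdmissibleRadii P L_X L_Y L_S η r s) {W : Triple m n d}
    (hW : W ∈ P.feasible) (hiso : ¬ P.Isolated r s W) :
    ∃ W' ∈ P.feasible, P.Frelax θ₁ r s W' < P.Frelax θ₁ r s W ∧
      supportCard W' < supportCard W := by
  obtain ⟨X, Y, S⟩ := W
  obtain ⟨hX, hY, hS⟩ := hW
  have hr : 0 < P.lam → r * L_X < P.lam * η ∧ r * L_Y < P.lam * η := fun hl => by
    have h0 : 0 < max L_X L_Y := lt_max_of_lt_left (hL.pos_X hl)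
    have h1 := (lt_div_iff₀ h0).1 (hrs.r_lt hl)
    exact ⟨(mul_le_mul_of_nonneg_left (le_max_left _ _) hrs.r_pos.le).trans_lt h1,
      (mul_le_mul_of_nonneg_left (le_max_right _ _) hrs.r_pos.le).trans_lt h1⟩
  rw [Isolated, not_and_or] at hiso
  rcases hiso with h | h
  · push Not at h
    obtain ⟨hl, k, hk⟩ := h
    by_cases hXk : ‖col X k‖ ∈ Ioo 0 r
    · refine ⟨(restrictCols {k}ᶜ X, Y, S), ⟨restrictCols_mem_ballSet hX _, hY, hS⟩, ?_, ?_⟩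
      · have h1 := hL.lip_X hl k (restrictCols {k}ᶜ X) X Y S
          ⟨restrictCols_mem_ballSet hX _, hY, hS⟩ ⟨hX, hY, hS⟩
          fun l hlk => col_restrictCols_of_mem (by simpa using hlk) X
        rw [col_restrictCols_of_notMem (by simp), zero_sub, norm_neg] at h1
        have h2 := (abs_le.1 h1).2
        have h3 := hθ.mul_lt_mul_theta hXk hl (hr hl).1
        simp only [Frelax, colPenalty_restrictCols hθ]
        linarith
      · have := ncard_restrictCols_lt (norm_pos_iff.1 hXk.1)
        exact Nat.add_lt_add_right (Nat.add_lt_add_right this _) _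
    · have hYk : ‖col Y k‖ ∈ Ioo 0 r := hk hXk
      refine ⟨(X, restrictCols {k}ᶜ Y, S), ⟨hX, restrictCols_mem_ballSet hY _, hS⟩, ?_, ?_⟩
      · have h1 := hL.lip_Y hl k X (restrictCols {k}ᶜ Y) Y S
          ⟨hX, restrictCols_mem_ballSet hY _, hS⟩ ⟨hX, hY, hS⟩
          fun l hlk => col_restrictCols_of_mem (by simpa using hlk) Y
        rw [col_restrictCols_of_notMem (by simp), zero_sub, norm_neg] at h1
        have h2 := (abs_le.1 h1).2
        have h3 := hθ.mul_lt_mul_theta hYk hl (hr hl).2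
        simp only [Frelax, colPenalty_restrictCols hθ]
        linarith
      · have := ncard_restrictCols_lt (norm_pos_iff.1 hYk.1)
        exact Nat.add_lt_add_right (Nat.add_lt_add_left this _) _
  · push Not at h
    obtain ⟨hb, i, j, hij⟩ := h
    refine ⟨(X, Y, restrictEntries {(i, j)}ᶜ S), ⟨hX, hY, restrictEntries_mem_boxSet hS _⟩, ?_, ?_⟩
    · have h1 := hL.lip_S hb (i, j) X Y (restrictEntries {(i, j)}ᶜ S) S
        ⟨hX, hY, restrictEntries_mem_boxSet hS _⟩ ⟨hX, hY, hS⟩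
        fun l hlk => restrictEntries_apply_of_mem (by simpa using hlk) S
      rw [restrictEntries_apply_of_notMem (by simp), zero_sub, abs_neg] at h1
      have h2 := (abs_le.1 h1).2
      have h3 := hθ.mul_lt_mul_theta hij hb ((lt_div_iff₀ (hL.pos_S hb)).1 (hrs.s_lt hb))
      simp only [Frelax, entryPenalty_restrictEntries hθ]
      linarith
    · have := ncard_restrictEntries_lt (abs_pos.1 hij.1)
      exact Nat.add_lt_add_left this _

theorem exists_isolated_le (hL : P.LipschitzOnFeasible L_X L_Y L_S)
    (hθ : IsGenerator θ₁ η) (hrs : AdmissibleRadii P L_X L_Y L_S η r s) (W : Triple m n d)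
    (hW : W ∈ P.feasible) :
    ∃ W' ∈ P.feasible, P.Isolated r s W' ∧ P.Frelax θ₁ r s W' ≤ P.Frelax θ₁ r s W := by
  induction hN : supportCard W using Nat.strong_induction_on generalizing W with
  | _ N ih =>
    by_cases hiso : P.Isolated r s W
    · exact ⟨W, hW, hiso, le_rfl⟩
    · obtain ⟨W₁, hW₁, hlt, hcard⟩ := exists_lt_of_not_isolated hL hθ hrs hW hiso
      obtain ⟨W₂, hW₂, hiso₂, hle⟩ := ih _ (hN ▸ hcard) W₁ hW₁ rfl
      exact ⟨W₂, hW₂, hiso₂, hle.trans hlt.le⟩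

theorem Frelax_le_F (hθ : IsGenerator θ₁ η) (r s : ℝ) (W : Triple m n d) :
    P.Frelax θ₁ r s W ≤ P.F W := by
  have hcol : ∀ {p : ℕ} (V : Mat p d), colPenalty θ₁ r V ≤ nnzc V := fun V =>
    Finset.sum_le_sum fun k _ => hθ.theta_div_le_vartheta (norm_nonneg _) r
  have hent : entryPenalty θ₁ s W.2.2 ≤ ell0 W.2.2 := Finset.sum_le_sum fun i _ =>
    Finset.sum_le_sum fun j _ => hθ.theta_div_le_vartheta (abs_nonneg _) s
  have h1 := mul_le_mul_of_nonneg_left (add_le_add (hcol W.1) (hcol W.2.1)) P.lam_nonneg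
  have h2 := mul_le_mul_of_nonneg_left hent P.beta_nonneg
  simp only [Frelax, F]
  linarith

theorem Frelax_eq_F (hθ : IsGenerator θ₁ η) (hrs : AdmissibleRadii P L_X L_Y L_S η r s)
    {W : Triple m n d} (hW : P.Isolated r s W) : P.Frelax θ₁ r s W = P.F W := by
  have h1 : P.lam * (colPenalty θ₁ r W.1 + colPenalty θ₁ r W.2.1) =
      P.lam * (nnzc W.1 + nnzc W.2.1) := by
    rcases P.lam_nonneg.eq_or_lt with hl | hl
    · rw [← hl, zero_mul, zero_mul]
    · congr 2
      · exact Finset.sum_congr rfl fun k _ =>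
          hθ.theta_div_eq_vartheta (norm_nonneg _) hrs.r_pos (hW.1 hl k).1
      · exact Finset.sum_congr rfl fun k _ =>
          hθ.theta_div_eq_vartheta (norm_nonneg _) hrs.r_pos (hW.1 hl k).2
  have h2 : P.beta * entryPenalty θ₁ s W.2.2 = P.beta * ell0 W.2.2 := by
    rcases P.beta_nonneg.eq_or_lt with hb | hb
    · rw [← hb, zero_mul, zero_mul]
    · congr 1
      exact Finset.sum_congr rfl fun i _ => Finset.sum_congr rfl fun j _ =>
        hθ.theta_div_eq_vartheta (abs_nonneg _) hrs.s_pos (hW.2 hb i j)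
  rw [Frelax, F, h1, h2]

theorem isolated_of_mem_globalMinRelax (hL : P.LipschitzOnFeasible L_X L_Y L_S)
    (hθ : IsGenerator θ₁ η) (hrs : AdmissibleRadii P L_X L_Y L_S η r s) {W : Triple m n d}
    (hW : W ∈ P.globalMinRelax θ₁ r s) : P.Isolated r s W := by
  by_contra h
  obtain ⟨W', hW', hlt, -⟩ := exists_lt_of_not_isolated hL hθ hrs hW.1 h
  exact (hW.2 W' hW').not_gt hlt

theorem globalMinRelax_eq_globalMin (hL : P.LipschitzOnFeasible L_X L_Y L_S)
    (hθ : IsGenerator θ₁ η) (hrs : AdmissibleRadii P L_X L_Y L_S η r s) :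
    P.globalMinRelax θ₁ r s = P.globalMin := by
  ext W
  refine ⟨fun hW => ⟨hW.1, fun W' hW' => ?_⟩, fun hW => ⟨hW.1, fun W' hW' => ?_⟩⟩
  · rw [← Frelax_eq_F hθ hrs (isolated_of_mem_globalMinRelax hL hθ hrs hW)]
    exact (hW.2 W' hW').trans (Frelax_le_F hθ r s W')
  · obtain ⟨W₂, hW₂, hiso, hle⟩ := exists_isolated_le hL hθ hrs W' hW'
    refine le_trans ?_ hle
    rw [Frelax_eq_F hθ hrs hiso]
    exact (Frelax_le_F hθ r s W).trans (hW.2 W₂ hW₂)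

theorem col_eq_zero_of_globalMin {W : Triple m n d} (hW : W ∈ P.globalMin) (hl : 0 < P.lam)
    (k : Fin d) : col W.1 k = 0 ↔ col W.2.1 k = 0 := by
  obtain ⟨X, Y, S⟩ := W
  obtain ⟨⟨hX, hY, hS⟩, hmin⟩ := hW
  refine ⟨fun h => ?_, fun h => ?_⟩
  · by_contra hne
    have h1 := hmin (X, restrictCols {k}ᶜ Y, S) ⟨hX, restrictCols_mem_ballSet hY _, hS⟩
    have h2 : mulT X (restrictCols {k}ᶜ Y) = mulT X Y := by
      ext e
      simp only [mulT]
      refine Finset.sum_congr rfl fun l _ => ?_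
      by_cases hlk : l = k
      · rw [hlk, col_eq_zero_iff.1 h, zero_mul, zero_mul]
      · simp [restrictCols, hlk]
    simp only [F, h2, nnzc_restrictCols] at h1
    have h3 : vartheta ‖col Y k‖ = 1 := if_pos (norm_pos_iff.2 hne)
    rw [h3] at h1
    linarith
  · by_contra hne
    have h1 := hmin (restrictCols {k}ᶜ X, Y, S) ⟨restrictCols_mem_ballSet hX _, hY, hS⟩
    have h2 : mulT (restrictCols {k}ᶜ X) Y = mulT X Y := by
      ext e
      simp only [mulT]
      refine Finset.sum_congr rfl fun l _ => ?_
      by_cases hlk : l = k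
      · rw [hlk, col_eq_zero_iff.1 h, mul_zero, mul_zero]
      · simp [restrictCols, hlk]
    simp only [F, h2, nnzc_restrictCols] at h1
    have h3 : vartheta ‖col X k‖ = 1 := if_pos (norm_pos_iff.2 hne)
    rw [h3] at h1
    linarith

theorem consistent_of_globalMin {W : Triple m n d} (hW : W ∈ P.globalMin) : P.Consistent W := by
  ext k
  exact forall_congr' fun hl => not_congr (col_eq_zero_of_globalMin hW hl k)

end Problem

/-! ### Subgradients of the frozen penalties -/

section FrozenPenalties

variable {p q : ℕ} {θ₁ : ℝ → ℝ} {η ρ : ℝ}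

theorem inner_single_right (w : Mat p q) (e : Fin p × Fin q) :
    inner ℝ w (EuclideanSpace.single e (1 : ℝ)) = w e := by
  simp [EuclideanSpace.inner_single_right]

theorem apply_eq_zero_of_mem_limitingSubdiff {g : Mat p q → ℝ} {x w : Mat p q} {e : Fin p × Fin q}
    (hg : ∀ y (t : ℝ), g (y + t • EuclideanSpace.single e (1 : ℝ)) = g y)
    (hw : w ∈ limitingSubdiff g x) : w e = 0 := by
  have := abs_inner_le_of_mem_limitingSubdiff (v := EuclideanSpace.single e (1 : ℝ)) (K := 0)
    (Eventually.of_forall fun y => Eventually.of_forall fun t => by rw [hg, zero_mul, add_zero]) hw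
  rw [inner_single_right] at this
  exact abs_nonpos_iff.1 this

theorem apply_eq_zero_of_mem_limitingSubdiff_colPenaltySel {I : Fin q → Bool} {V G : Mat p q}
    (hG : G ∈ limitingSubdiff (colPenaltySel θ₁ ρ I) V) {e : Fin p × Fin q} (he : I e.2 = true) :
    G e = 0 := by
  refine apply_eq_zero_of_mem_limitingSubdiff (fun y t => Finset.sum_congr rfl fun l _ => ?_) hG
  by_cases hl : l = e.2
  · rw [hl, he]; rfl
  · have : col (y + t • EuclideanSpace.single e (1 : ℝ)) l = col y l := by
      ext i
      have : (i, l) ≠ e := fun h => hl (by rw [← h])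
      simp [col, this]
    rw [this]

theorem apply_eq_zero_of_mem_limitingSubdiff_entryPenaltySel {J : Fin p → Fin q → Bool}
    {S G : Mat p q} (hG : G ∈ limitingSubdiff (entryPenaltySel θ₁ ρ J) S) {e : Fin p × Fin q}
    (he : J e.1 e.2 = true) : G e = 0 := by
  refine apply_eq_zero_of_mem_limitingSubdiff (fun y t => ?_) hG
  rw [entryPenaltySel_eq_sum, entryPenaltySel_eq_sum]
  refine Finset.sum_congr rfl fun l _ => ?_
  by_cases hl : l = e
  · rw [hl, he]; rfl
  · have : (y + t • EuclideanSpace.single e (1 : ℝ)) l = y l := by simp [hl]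
    rw [this]

theorem zero_mem_limitingSubdiff_colPenaltySel (hθ : IsGenerator θ₁ η) (hρ : 0 < ρ)
    {I : Fin q → Bool} {V : Mat p q} (hI : ∀ k, I k = false → col V k = 0) :
    0 ∈ limitingSubdiff (colPenaltySel θ₁ ρ I) V := by
  refine mem_limitingSubdiff_of_eventually_le (Eventually.of_forall fun y => ?_)
  rw [inner_zero_left, add_zero]
  refine Finset.sum_le_sum fun k _ => ?_
  cases hk : I k
  · rw [hI k hk, norm_zero, zero_div]
    exact hθ.zero.le.trans (hθ.nonneg (by positivity))
  · exact le_rfl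

/-- Near a matrix whose entries carrying the label `1` vanish, the frozen penalty has a kink of
slope at least `η / ρ` in each of these entries and is constant in the others. -/
theorem mem_limitingSubdiff_entryPenaltySel (hθ : IsGenerator θ₁ η) (hρ : 0 < ρ)
    {J : Fin p → Fin q → Bool} {S G : Mat p q}
    (hJ : ∀ e : Fin p × Fin q, J e.1 e.2 = false → S e = 0 ∧ |G e| ≤ η / ρ)
    (hJ' : ∀ e : Fin p × Fin q, J e.1 e.2 = true → G e = 0) :
    G ∈ limitingSubdiff (entryPenaltySel θ₁ ρ J) S := by
  have hnear : ∀ᶠ y in 𝓝 S, ∀ e, S e = 0 → |y e| < ρ := by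
    refine eventually_all.2 fun e => ?_
    by_cases he : S e = 0
    · have hc : Continuous fun y : Mat p q => |y e| := by fun_prop
      have h0 : |S e| < ρ := by rwa [he, abs_zero]
      have := (hc.tendsto S).eventually (gt_mem_nhds h0)
      filter_upwards [this] with y hy _ using hy
    · exact Eventually.of_forall fun y h => absurd h he
  refine mem_limitingSubdiff_of_eventually_le ?_
  filter_upwards [hnear] with y hy
  rw [entryPenaltySel_eq_sum, entryPenaltySel_eq_sum, PiLp.inner_apply, ← Finset.sum_add_distrib]
  refine Finset.sum_le_sum fun e _ => ?_
  cases he : J e.1 e.2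
  · obtain ⟨hS, hG⟩ := hJ e he
    have h1 := hθ.eta_mul_le (div_nonneg (abs_nonneg (y e)) hρ.le)
      ((div_le_one hρ).2 (hy e hS).le)
    have h2 : G e * y e ≤ η / ρ * |y e| :=
      (le_abs_self _).trans ((abs_mul _ _).le.trans
        (mul_le_mul_of_nonneg_right hG (abs_nonneg _)))
    have h3 : η / ρ * |y e| = η * (|y e| / ρ) := by ring
    simp only [thetaSel, PiLp.sub_apply, hS, abs_zero, zero_div, sub_zero, RCLike.inner_apply,
      conj_trivial, Bool.false_eq_true, if_false, hθ.zero, zero_add]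
    linarith
  · simp [thetaSel, theta₂, hJ' e he]

/-- A weighted `ℓ¹` norm of the entries in `T` bounds its subgradients entrywise. -/
theorem abs_apply_le_of_mem_limitingSubdiff_sum {L : ℝ} (T : Finset (Fin p × Fin q)) (hL : 0 ≤ L)
    {S Q : Mat p q} (hQ : Q ∈ limitingSubdiff (fun U : Mat p q => ∑ e ∈ T, L * |U e|) S)
    (e : Fin p × Fin q) : |Q e| ≤ L := by
  rw [← inner_single_right Q e]
  refine abs_inner_le_of_mem_limitingSubdiff
    (Eventually.of_forall fun y => Eventually.of_forall fun t => ?_) hQ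
  have h1 : ∀ e' ∈ T, L * |(y + t • EuclideanSpace.single e (1 : ℝ)) e'| ≤
      L * |y e'| + if e' = e then L * |t| else 0 := fun e' _ => by
    by_cases h : e' = e
    · have h2 : (y + t • EuclideanSpace.single e (1 : ℝ)) e' = y e' + t := by simp [h]
      rw [if_pos h, h2, ← mul_add]
      exact mul_le_mul_of_nonneg_left (abs_add_le _ _) hL
    · simp [h]
  refine (Finset.sum_le_sum h1).trans ?_
  rw [Finset.sum_add_distrib, Finset.sum_ite_eq']
  have : 0 ≤ L * |t| := by positivity
  split_ifs <;> linarith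

theorem locallyLipschitz_sum_abs {L : ℝ} (T : Finset (Fin p × Fin q)) (hL : 0 ≤ L) :
    LocallyLipschitz fun U : Mat p q => ∑ e ∈ T, L * |U e| := by
  refine (LipschitzWith.of_le_add_mul' (∑ _e ∈ T, L) fun x y => ?_).locallyLipschitz
  rw [Finset.sum_mul, ← Finset.sum_add_distrib]
  refine Finset.sum_le_sum fun e _ => ?_
  rw [← mul_add]
  refine mul_le_mul_of_nonneg_left ?_ hL
  have h1 : |x e - y e| ≤ dist x y := by
    rw [dist_eq_norm, ← Real.norm_eq_abs]
    exact PiLp.norm_apply_le (x - y) e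
  have h2 := abs_sub_abs_le_abs_sub (x e) (y e)
  linarith

end FrozenPenalties

/-! ### Stationarity -/

namespace Problem

variable {m n d : ℕ} {P : Problem m n d} {θ₁ : ℝ → ℝ} {L_X L_Y L_S η r s : ℝ}

theorem notMem_colSupport_iff {p : ℕ} {V : Mat p d} {k : Fin d} :
    k ∉ P.colSupport V ↔ 0 < P.lam ∧ col V k = 0 := by
  simp [colSupport]

theorem notMem_entrySupport_iff {S : Mat m n} {e : Fin m × Fin n} :
    e ∉ P.entrySupport S ↔ 0 < P.beta ∧ S e = 0 := by
  simp [entrySupport]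

theorem restrictEntries_colSupport {p : ℕ} (V : Mat p d) :
    restrictEntries {e | e.2 ∈ P.colSupport V} V = V :=
  restrictEntries_eq_self_iff.2 fun _ he =>
    col_eq_zero_iff.1 (notMem_colSupport_iff.1 he).2 _

theorem restrictEntries_entrySupport (S : Mat m n) :
    restrictEntries (P.entrySupport S) S = S :=
  restrictEntries_eq_self_iff.2 fun _ he => (notMem_entrySupport_iff.1 he).2

theorem colIndex_eq_true_iff (hθ : IsGenerator θ₁ η) (hr : 0 < r) {p : ℕ} {V : Mat p d}
    (hV : 0 < P.lam → ∀ k, ‖col V k‖ ∉ Ioo 0 r) (k : Fin d) :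
    P.colIndex θ₁ r V k = true ↔ k ∈ P.colSupport V := by
  by_cases hl : 0 < P.lam
  · simp only [colIndex, hl, if_true, colSupport, mem_ofPred_eq, forall_const]
    rw [hθ.activeIndex_eq_true_iff (norm_nonneg _) hr (hV hl k), norm_ne_zero_iff]
  · simp [colIndex, hl, colSupport]

theorem entryIndex_eq_true_iff (hθ : IsGenerator θ₁ η) (hs : 0 < s) {S : Mat m n}
    (hS : 0 < P.beta → ∀ i j, |S (i, j)| ∉ Ioo 0 s) (e : Fin m × Fin n) :
    P.entryIndex θ₁ s S e.1 e.2 = true ↔ e ∈ P.entrySupport S := by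
  by_cases hb : 0 < P.beta
  · simp only [entryIndex, hb, if_true, entrySupport, mem_ofPred_eq, forall_const]
    rw [hθ.activeIndex_eq_true_iff (abs_nonneg _) hs (hS hb e.1 e.2), abs_ne_zero]
  · simp [entryIndex, hb, entrySupport]

/-- A column block of (FB)-stationarity gives the one of (FR)-stationarity, with the zero
subgradient, if the normal vector vanishes off the support. -/
theorem exists_colRelax_of_mem_normalCone (hθ : IsGenerator θ₁ η) (hr : 0 < r) {p : ℕ}
    {V u : Mat p d} (hV : 0 < P.lam → ∀ k, ‖col V k‖ ∉ Ioo 0 r)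
    (hu : -u ∈ normalCone (restrictCols (P.colSupport V) '' P.ballSet p) V)
    (hu0 : ∀ e : Fin p × Fin d, e.2 ∉ P.colSupport V → u e = 0) :
    ∃ G ∈ limitingSubdiff (colPenaltySel θ₁ r (P.colIndex θ₁ r V)) V,
      ∃ v ∈ normalCone (P.ballSet p) V, 0 = u + P.lam • G + v := by
  refine ⟨0, zero_mem_limitingSubdiff_colPenaltySel hθ hr fun k hk => ?_, -u, ?_, by simp⟩
  · have : k ∉ P.colSupport V := fun h => by
      rw [(colIndex_eq_true_iff hθ hr hV k).2 h] at hk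
      exact Bool.noConfusion hk
    exact (notMem_colSupport_iff.1 this).2
  · have h := (P.splitsAlong_ballSet p (P.colSupport V)).restrict_mem_normalCone hu
    rwa [restrictEntries_eq_self_iff.2 fun e he => by
      rw [PiLp.neg_apply, hu0 e he, neg_zero]] at h

theorem mem_normalCone_of_colRelax (hθ : IsGenerator θ₁ η) (hr : 0 < r) {p : ℕ}
    {V u : Mat p d} (hV : 0 < P.lam → ∀ k, ‖col V k‖ ∉ Ioo 0 r)
    (h : ∃ G ∈ limitingSubdiff (colPenaltySel θ₁ r (P.colIndex θ₁ r V)) V,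
      ∃ v ∈ normalCone (P.ballSet p) V, 0 = u + P.lam • G + v) :
    -u ∈ normalCone (restrictCols (P.colSupport V) '' P.ballSet p) V := by
  obtain ⟨G, hG, v, hv, h0⟩ := h
  refine (P.splitsAlong_ballSet p _).mem_normalCone_image hv (restrictEntries_colSupport V) ?_
  ext e
  by_cases he : e.2 ∈ P.colSupport V
  · rw [restrictEntries_apply_of_mem he, restrictEntries_apply_of_mem he]
    have h1 := apply_eq_zero_of_mem_limitingSubdiff_colPenaltySel hG
      ((colIndex_eq_true_iff hθ hr hV e.2).2 he)
    have h2 : (0 : ℝ) = u e + P.lam * G e + v e :=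
      congrArg (fun U : Mat p d => U e) h0
    rw [h1] at h2
    rw [PiLp.neg_apply]
    linarith
  · rw [restrictEntries_apply_of_notMem he, restrictEntries_apply_of_notMem he]

theorem mem_normalCone_of_entryRelax (hθ : IsGenerator θ₁ η) (hs : 0 < s)
    {S u : Mat m n} (hS : 0 < P.beta → ∀ i j, |S (i, j)| ∉ Ioo 0 s)
    (h : ∃ G ∈ limitingSubdiff (entryPenaltySel θ₁ s (P.entryIndex θ₁ s S)) S,
      ∃ v ∈ normalCone P.boxSet S, 0 = u + P.beta • G + v) :
    -u ∈ normalCone (restrictEntries (P.entrySupport S) '' P.boxSet) S := by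
  obtain ⟨G, hG, v, hv, h0⟩ := h
  refine (P.splitsAlong_boxSet _).mem_normalCone_image hv (restrictEntries_entrySupport S) ?_
  ext e
  by_cases he : e ∈ P.entrySupport S
  · rw [restrictEntries_apply_of_mem he, restrictEntries_apply_of_mem he]
    have h1 := apply_eq_zero_of_mem_limitingSubdiff_entryPenaltySel hG
      ((entryIndex_eq_true_iff hθ hs hS e).2 he)
    have h2 : (0 : ℝ) = u e + P.beta * G e + v e :=
      congrArg (fun U : Mat m n => U e) h0
    rw [h1] at h2
    rw [PiLp.neg_apply]
    linarith
  · rw [restrictEntries_apply_of_notMem he, restrictEntries_apply_of_notMem he]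

/-- The choice of `s` makes every `Q` supported off the support of `S`, with entries bounded by
`L_S`, a multiple `β G` of a subgradient `G` of the frozen penalty. -/
theorem exists_entryRelax (hL : P.LipschitzOnFeasible L_X L_Y L_S)
    (hθ : IsGenerator θ₁ η) (hrs : AdmissibleRadii P L_X L_Y L_S η r s) {S u Q : Mat m n}
    (hS : 0 < P.beta → ∀ i j, |S (i, j)| ∉ Ioo 0 s)
    (hQ : ∀ e ∈ P.entrySupport S, Q e = 0) (hQ' : 0 < P.beta → ∀ e, |Q e| ≤ L_S)
    (hu : -u - Q ∈ normalCone P.boxSet S) :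
    ∃ G ∈ limitingSubdiff (entryPenaltySel θ₁ s (P.entryIndex θ₁ s S)) S,
      ∃ v ∈ normalCone P.boxSet S, 0 = u + P.beta • G + v := by
  have hidx := entryIndex_eq_true_iff (P := P) hθ hrs.s_pos hS
  have hmem : P.beta⁻¹ • Q ∈ limitingSubdiff (entryPenaltySel θ₁ s (P.entryIndex θ₁ s S)) S := by
    refine mem_limitingSubdiff_entryPenaltySel hθ hrs.s_pos (fun e he => ?_) fun e he => ?_
    · have : e ∉ P.entrySupport S := fun h => by
        rw [(hidx e).2 h] at he
        exact Bool.noConfusion he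
      obtain ⟨hb, hSe⟩ := notMem_entrySupport_iff.1 this
      refine ⟨hSe, ?_⟩
      have h1 := (lt_div_iff₀ (hL.pos_S hb)).1 (hrs.s_lt hb)
      rw [PiLp.smul_apply, smul_eq_mul, abs_mul, abs_of_pos (inv_pos.2 hb),
        inv_mul_le_iff₀ hb, ← mul_div_assoc, le_div_iff₀ hrs.s_pos]
      have := mul_le_mul_of_nonneg_right (hQ' hb e) hrs.s_pos.le
      linarith
    · rw [PiLp.smul_apply, hQ e ((hidx e).1 he), smul_zero]
  refine ⟨_, hmem, _, hu, ?_⟩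
  have : P.beta • P.beta⁻¹ • Q = Q := by
    rcases P.beta_nonneg.eq_or_lt with hb | hb
    · have : Q = 0 := by
        ext e
        exact hQ e fun h => absurd hb h.ne
      rw [this, smul_zero, smul_zero]
    · rw [smul_smul, mul_inv_cancel₀ hb.ne', one_smul]
  rw [this]
  abel

theorem mul_apply_eq_zero {H : Mat m n} {Y : Mat n d} {e : Fin m × Fin d} (h : col Y e.2 = 0) :
    mul H Y e = 0 := by
  simp only [mul]
  exact Finset.sum_eq_zero fun j _ => by rw [col_eq_zero_iff.1 h, mul_zero]

theorem tmul_apply_eq_zero {H : Mat m n} {X : Mat m d} {e : Fin n × Fin d} (h : col X e.2 = 0) :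
    tmul H X e = 0 := by
  simp only [tmul]
  exact Finset.sum_eq_zero fun j _ => by rw [col_eq_zero_iff.1 h, mul_zero]

/-- The column blocks pass from (FB) to (FR) under consistency: where a column of `X` vanishes, so
does the column of `Y`, hence that of `H Y`. -/
theorem exists_colRelax_pair (hθ : IsGenerator θ₁ η) (hr : 0 < r) {X : Mat m d} {Y : Mat n d}
    {H : Mat m n} (hXY : P.colSupport X = P.colSupport Y)
    (hX : 0 < P.lam → ∀ k, ‖col X k‖ ∉ Ioo 0 r) (hY : 0 < P.lam → ∀ k, ‖col Y k‖ ∉ Ioo 0 r)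
    (hNX : -(mul H Y) ∈ normalCone (restrictCols (P.colSupport X) '' P.ballSet m) X)
    (hNY : -(tmul H X) ∈ normalCone (restrictCols (P.colSupport Y) '' P.ballSet n) Y) :
    (∃ G ∈ limitingSubdiff (colPenaltySel θ₁ r (P.colIndex θ₁ r X)) X,
      ∃ v ∈ normalCone (P.ballSet m) X, 0 = mul H Y + P.lam • G + v) ∧
    (∃ G ∈ limitingSubdiff (colPenaltySel θ₁ r (P.colIndex θ₁ r Y)) Y,
      ∃ v ∈ normalCone (P.ballSet n) Y, 0 = tmul H X + P.lam • G + v) :=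
  ⟨exists_colRelax_of_mem_normalCone hθ hr hX hNX fun _ he =>
      mul_apply_eq_zero (notMem_colSupport_iff.1 (hXY ▸ he)).2,
    exists_colRelax_of_mem_normalCone hθ hr hY hNY fun _ he =>
      tmul_apply_eq_zero (notMem_colSupport_iff.1 (hXY ▸ he)).2⟩

theorem strongStationaryRelax_subset (hθ : IsGenerator θ₁ η)
    (hrs : AdmissibleRadii P L_X L_Y L_S η r s) :
    P.strongStationaryRelax θ₁ r s ⊆ P.strongStationary r s := by
  rintro W ⟨⟨hW, H, hH, hX, hY, hS⟩, hcons, hiso⟩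
  exact ⟨⟨hW, H, hH,
    mem_normalCone_of_colRelax hθ hrs.r_pos (fun hl k => (hiso.1 hl k).1) hX,
    mem_normalCone_of_colRelax hθ hrs.r_pos (fun hl k => (hiso.1 hl k).2) hY,
    mem_normalCone_of_entryRelax hθ hrs.s_pos hiso.2 hS⟩, hcons, hiso⟩

theorem loss_restrictEntries_le (hL : P.LipschitzOnFeasible L_X L_Y L_S) (hb : 0 < P.beta)
    {X : Mat m d} {Y : Mat n d} {S : Mat m n} (hW : (X, Y, S) ∈ P.feasible)
    (T : Finset (Fin m × Fin n)) :
    P.f (mulT X Y) (restrictEntries (↑T)ᶜ S) ≤ P.f (mulT X Y) S + ∑ e ∈ T, L_S * |S e| := by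
  classical
  induction T using Finset.induction_on with
  | empty =>
    rw [restrictEntries_eq_self_iff.2 (by simp), Finset.sum_empty, add_zero]
  | insert a T ha ih =>
    have h1 := hL.lip_S hb a X Y (restrictEntries (↑(insert a T))ᶜ S) (restrictEntries (↑T)ᶜ S)
      ⟨hW.1, hW.2.1, restrictEntries_mem_boxSet hW.2.2 _⟩
      ⟨hW.1, hW.2.1, restrictEntries_mem_boxSet hW.2.2 _⟩ fun e he => by
        simp [restrictEntries, he]
    rw [restrictEntries_apply_of_notMem (by simp), restrictEntries_apply_of_mem (by simpa using ha),
      zero_sub, abs_neg] at h1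
    rw [Finset.sum_insert ha]
    have h2 := (abs_le.1 h1).2
    linarith

/-- On the set of triples supported in the support of a global minimizer `W` of (FB), the loss is
minimal at `W`, since there the regularizers do not exceed their values at `W`. -/
theorem loss_le_of_globalMin {W : Triple m n d} (hW : W ∈ P.globalMin) {W' : Triple m n d}
    (hW' : W' ∈ P.feasible) (hX : ∀ k ∉ P.colSupport W.1, col W'.1 k = 0)
    (hY : ∀ k ∉ P.colSupport W.2.1, col W'.2.1 k = 0)
    (hS : ∀ e ∉ P.entrySupport W.2.2, W'.2.2 e = 0) :
    P.f (mulT W.1 W.2.1) W.2.2 ≤ P.f (mulT W'.1 W'.2.1) W'.2.2 := by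
  have hle1 : ∀ a : ℝ, vartheta a ≤ 1 := fun a => by unfold vartheta; split_ifs <;> norm_num
  have hcol : 0 < P.lam → ∀ {p : ℕ} (V V' : Mat p d), (∀ k ∉ P.colSupport V, col V' k = 0) →
      nnzc V' ≤ nnzc V := fun hl p V V' h => Finset.sum_le_sum fun k _ => by
    by_cases hk : col V k = 0
    · rw [h k (notMem_colSupport_iff.2 ⟨hl, hk⟩), hk]
    · rw [show vartheta ‖col V k‖ = 1 from if_pos (norm_pos_iff.2 hk)]
      exact hle1 _
  have h1 : P.lam * (nnzc W'.1 + nnzc W'.2.1) ≤ P.lam * (nnzc W.1 + nnzc W.2.1) := by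
    rcases P.lam_nonneg.eq_or_lt with hl | hl
    · rw [← hl, zero_mul, zero_mul]
    · exact mul_le_mul_of_nonneg_left (add_le_add (hcol hl _ _ hX) (hcol hl _ _ hY)) hl.le
  have h2 : P.beta * ell0 W'.2.2 ≤ P.beta * ell0 W.2.2 := by
    rcases P.beta_nonneg.eq_or_lt with hb | hb
    · rw [← hb, zero_mul, zero_mul]
    · refine mul_le_mul_of_nonneg_left ?_ hb.le
      rw [ell0_eq_sum, ell0_eq_sum]
      refine Finset.sum_le_sum fun e _ => ?_
      by_cases he : W.2.2 e = 0
      · rw [hS e (notMem_entrySupport_iff.2 ⟨hb, he⟩), he]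
      · rw [show vartheta |W.2.2 e| = 1 from if_pos (abs_pos.2 he)]
        exact hle1 _
  have h3 := hW.2 W' hW'
  simp only [F] at h3
  linarith

/-- A global minimizer is stationary for (FR). Zeroing the entries of `S'` outside the support of
`S` costs at most `L_S` times their absolute values, so `(X, Y, S)` minimizes
`f (X' Y'ᵀ) S' + L_S ∑ |S'ₑ|`, the sum over `e` outside the support of `S`, on the set where `X'`
and `Y'` keep their column supports. The `ℓ¹` term provides the subgradient in the `S` block. -/
theorem globalMin_subset_strongStationaryRelax (hL : P.LipschitzOnFeasible L_X L_Y L_S)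
    (hθ : IsGenerator θ₁ η) (hrs : AdmissibleRadii P L_X L_Y L_S η r s) :
    P.globalMin ⊆ P.strongStationaryRelax θ₁ r s := by
  classical
  intro W hW
  have hiso : P.Isolated r s W := isolated_of_mem_globalMinRelax hL hθ hrs
    (by rwa [globalMinRelax_eq_globalMin hL hθ hrs])
  have hcons := consistent_of_globalMin hW
  obtain ⟨X, Y, S⟩ := W
  obtain ⟨hX, hY, hS⟩ := hW.1
  -- for `β = 0` the constant `L_S` is arbitrary, but then no entry is outside the support
  obtain ⟨L, hL0, hLS⟩ : ∃ L : ℝ, 0 ≤ L ∧ (0 < P.beta → L = L_S) := by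
    by_cases hb : 0 < P.beta
    · exact ⟨L_S, (hL.pos_S hb).le, fun _ => rfl⟩
    · exact ⟨0, le_rfl, fun h => absurd h hb⟩
  let T : Finset (Fin m × Fin n) := Finset.univ.filter fun e => e ∉ P.entrySupport S
  have hT : ∀ e, e ∈ T ↔ e ∉ P.entrySupport S := fun e => by simp [T]
  have hTS : ((T : Set (Fin m × Fin n)))ᶜ = P.entrySupport S := by
    ext e
    rw [mem_compl_iff, Finset.mem_coe, hT, not_not]
  have hball := P.splitsAlong_ballSet
  have hmin : ∀ X' ∈ restrictCols (P.colSupport X) '' P.ballSet m,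
      ∀ Y' ∈ restrictCols (P.colSupport Y) '' P.ballSet n, ∀ S' ∈ P.boxSet,
      P.f (mulT X Y) S + ∑ e ∈ T, L * |S e| ≤ P.f (mulT X' Y') S' + ∑ e ∈ T, L * |S' e| := by
    rintro _ ⟨X', hX', rfl⟩ _ ⟨Y', hY', rfl⟩ S' hS'
    have h0 : ∑ e ∈ T, L * |S e| = 0 := Finset.sum_eq_zero fun e he => by
      rw [(notMem_entrySupport_iff.1 ((hT e).1 he)).2, abs_zero, mul_zero]
    have h1 := loss_le_of_globalMin hW
      (W' := (restrictCols (P.colSupport X) X', restrictCols (P.colSupport Y) Y',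
        restrictEntries (P.entrySupport S) S'))
      ⟨restrictCols_mem_ballSet hX' _, restrictCols_mem_ballSet hY' _,
        restrictEntries_mem_boxSet hS' _⟩
      (fun k hk => col_restrictCols_of_notMem hk _) (fun k hk => col_restrictCols_of_notMem hk _)
      fun e he => restrictEntries_apply_of_notMem he _
    rw [h0, add_zero]
    refine h1.trans ?_
    by_cases hb : 0 < P.beta
    · rw [← hTS, hLS hb]
      exact loss_restrictEntries_le hL hb
        ⟨restrictCols_mem_ballSet hX' _, restrictCols_mem_ballSet hY' _, hS'⟩ T
    · have hJ : ∀ e, e ∈ P.entrySupport S := fun e h => absurd h hb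
      rw [restrictEntries_eq_self_iff.2 fun e he => absurd (hJ e) he]
      exact le_add_of_nonneg_right (Finset.sum_nonneg fun e _ => by positivity)
  have hXI : X ∈ restrictCols (P.colSupport X) '' P.ballSet m :=
    (hball m _).mem_image_iff.2 ⟨hX, restrictEntries_colSupport X⟩
  have hYI : Y ∈ restrictCols (P.colSupport Y) '' P.ballSet n :=
    (hball n _).mem_image_iff.2 ⟨hY, restrictEntries_colSupport Y⟩
  obtain ⟨H, hH, Q, hQ, hNX, hNY, hNS⟩ := exists_factorization_multiplier (X := X) (Y := Y)
    P.f_locallyLipschitz (locallyLipschitz_sum_abs T hL0)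
    ((hball m (P.colSupport X)).isClosed_image (P.isClosed_ballSet m))
    ((hball n (P.colSupport Y)).isClosed_image (P.isClosed_ballSet n)) P.isClosed_boxSet
    hXI hYI hS hmin
  obtain ⟨hRX, hRY⟩ := exists_colRelax_pair hθ hrs.r_pos hcons
    (fun hl k => (hiso.1 hl k).1) (fun hl k => (hiso.1 hl k).2) hNX hNY
  refine ⟨⟨hW.1, H, hH, hRX, hRY, exists_entryRelax hL hθ hrs hiso.2 (fun e he => ?_)
    (fun hb e => ?_) hNS⟩, hcons, hiso⟩
  · refine apply_eq_zero_of_mem_limitingSubdiff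
      (fun y t => Finset.sum_congr rfl fun e' he' => ?_) hQ
    have : e' ≠ e := fun h => (hT e').1 he' (h ▸ he)
    simp [this]
  · rw [← hLS hb]
    exact abs_apply_le_of_mem_limitingSubdiff_sum T hL0 hQ e

theorem abs_apply_le_of_entryModulusLE (hM : P.EntryModulusLE L_S) (hb : 0 < P.beta)
    {X : Mat m d} {Y : Mat n d} {S : Mat m n} (hW : (X, Y, S) ∈ P.feasible)
    {H : Mat m n × Mat m n} (hH : H ∈ P.lossSubdiff (mulT X Y) S) {e : Fin m × Fin n}
    (he : P.kappa₁ e.1 e.2 < P.kappa₂ e.1 e.2) : |H.2 e| ≤ L_S := by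
  refine le_of_forall_gt_imp_ge_of_dense fun L' hL' => ?_
  obtain ⟨U, hU, hlip⟩ := hM hb X Y S hW e.1 e.2 he L' hL'
  let v : WithLp 2 (Mat m n × Mat m n) := WithLp.toLp 2 (0, EuclideanSpace.single e (1 : ℝ))
  have hv : inner ℝ (WithLp.toLp 2 H) v = H.2 e := by
    rw [WithLp.prod_inner_apply]
    simp [v, EuclideanSpace.inner_single_right]
  rw [← hv]
  refine abs_inner_le_of_mem_limitingSubdiff ?_ hH
  have hc : Continuous fun y : WithLp 2 (Mat m n × Mat m n) => (y.fst, y.snd) := by fun_prop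
  have hU' : ∀ᶠ y : WithLp 2 (Mat m n × Mat m n) in 𝓝 (WithLp.toLp 2 (mulT X Y, S)),
      (y.fst, y.snd) ∈ U := (hc.tendsto _).eventually hU
  filter_upwards [hU'.eventually_nhds] with y hy
  have hyt : Tendsto (fun t : ℝ => y + t • v) (𝓝 0) (𝓝 y) := by
    have : Continuous fun t : ℝ => y + t • v := by fun_prop
    simpa using this.tendsto 0
  filter_upwards [hyt.eventually hy] with t ht
  have hfst : (y + t • v).fst = y.fst := by simp [v]
  have hsnd : (y + t • v).snd = y.snd + t • EuclideanSpace.single e (1 : ℝ) := by simp [v]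
  rw [hfst, hsnd] at ht ⊢
  have h1 := hlip y.fst _ y.snd ht hy.self_of_nhds fun e' he' => by
    have : e' ≠ e := he'
    simp [this]
  have h2 : (y.snd + t • EuclideanSpace.single e (1 : ℝ)) (e.1, e.2) - y.snd (e.1, e.2) = t := by
    simp
  rw [h2] at h1
  have := (abs_le.1 h1).2
  linarith

theorem strongStationary_subset_of_entryModulusLE (hL : P.LipschitzOnFeasible L_X L_Y L_S)
    (hθ : IsGenerator θ₁ η) (hrs : AdmissibleRadii P L_X L_Y L_S η r s)
    (hM : P.EntryModulusLE L_S) : P.strongStationary r s ⊆ P.strongStationaryRelax θ₁ r s := by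
  rintro ⟨X, Y, S⟩ ⟨⟨hW, H, hH, hNX, hNY, hNS⟩, hcons, hiso⟩
  obtain ⟨hRX, hRY⟩ := exists_colRelax_pair hθ hrs.r_pos hcons
    (fun hl k => (hiso.1 hl k).1) (fun hl k => (hiso.1 hl k).2) hNX hNY
  -- entries with the degenerate interval `{0}` may be added to the support of `S`
  let J : Set (Fin m × Fin n) := P.entrySupport S ∪ {e | ¬ P.kappa₁ e.1 e.2 < P.kappa₂ e.1 e.2}
  have hdeg : ∀ T ∈ P.boxSet, ∀ e : Fin m × Fin n, ¬ P.kappa₁ e.1 e.2 < P.kappa₂ e.1 e.2 →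
      T e = 0 := fun T hT e he => by
    obtain ⟨h1, h2⟩ := hT e.1 e.2
    have h3 := not_lt.1 he
    have h4 : ((T e : ℝ) : EReal) ≤ 0 := h2.trans (h3.trans (P.kappa₁_nonpos _ _))
    have h5 : (0 : EReal) ≤ ((T e : ℝ) : EReal) := (P.kappa₂_nonneg _ _).trans (h3.trans h1)
    exact le_antisymm (EReal.coe_nonpos.1 h4) (EReal.coe_nonneg.1 h5)
  have himg : restrictEntries J '' P.boxSet = restrictEntries (P.entrySupport S) '' P.boxSet := by
    ext T
    rw [(P.splitsAlong_boxSet _).mem_image_iff, (P.splitsAlong_boxSet _).mem_image_iff,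
      restrictEntries_eq_self_iff, restrictEntries_eq_self_iff]
    refine and_congr_right fun hT => ⟨fun h e he => ?_, fun h e he => h e fun h' => he (Or.inl h')⟩
    by_cases hd : P.kappa₁ e.1 e.2 < P.kappa₂ e.1 e.2
    · exact h e (by rintro (h' | h'); exacts [he h', h' hd])
    · exact hdeg T hT e hd
  have hN : restrictEntries J (-H.2) ∈ normalCone P.boxSet S :=
    (P.splitsAlong_boxSet J).restrict_mem_normalCone (by rw [himg]; exact hNS)
  refine ⟨⟨hW, H, hH, hRX, hRY,
    exists_entryRelax (Q := -H.2 - restrictEntries J (-H.2)) hL hθ hrs hiso.2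
      (fun e he => ?_) (fun hb e => ?_) (by rwa [sub_sub_cancel])⟩, hcons, hiso⟩
  · rw [PiLp.sub_apply, restrictEntries_apply_of_mem (Or.inl he), sub_self]
  · rw [PiLp.sub_apply]
    by_cases he : e ∈ J
    · rw [restrictEntries_apply_of_mem he, sub_self, abs_zero]
      exact (hL.pos_S hb).le
    · rw [restrictEntries_apply_of_notMem he, sub_zero, PiLp.neg_apply, abs_neg]
      exact abs_apply_le_of_entryModulusLE hM hb hW hH (not_not.1 fun h => he (Or.inr h))

end Problem

end RPCA

theorem mainTheorem3 {m n d : ℕ} (P : RPCA.Problem m n d) (θ₁ : ℝ → ℝ)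
    (L_X L_Y L_S η r s : ℝ)
    (hL : P.LipschitzOnFeasible L_X L_Y L_S)
    (hθ : RPCA.IsGenerator θ₁ η)
    (hrs : RPCA.AdmissibleRadii P L_X L_Y L_S η r s) :
    P.globalMinRelax θ₁ r s = P.globalMin ∧
    P.globalMin ⊆ P.strongStationary r s ∧
    P.globalMin ⊆ P.strongStationaryRelax θ₁ r s ∧
    P.strongStationaryRelax θ₁ r s ⊆ P.strongStationary r s ∧
    (P.EntryModulusLE L_S → P.strongStationary r s = P.strongStationaryRelax θ₁ r s) := by
  have h1 := RPCA.Problem.globalMin_subset_strongStationaryRelax hL hθ hrs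
  have h2 := RPCA.Problem.strongStationaryRelax_subset hθ hrs
  exact ⟨RPCA.Problem.globalMinRelax_eq_globalMin hL hθ hrs, h1.trans h2, h1, h2, fun hM =>
    (RPCA.Problem.strongStationary_subset_of_entryModulusLE hL hθ hrs hM).antisymm h2⟩
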